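/- Let $m,r\ge 1$, $n\ge 2$, $d=n-1$, and let $\xi_1,\dots,\xi_d>0$ with $\sum_j\xi_j=1$. Tensors $\mathcal F\in\mathbb C^{n\times\cdots\times n}$ of order $m$ carry the norm $\|\mathcal F\|=(\sum|\mathcal F_{i_1\dots i_m}|^2)^{1/2}$. Coordinates of vectors in $\mathbb C^n$ are numbered $0,\dots,d$, and $\bar v=(v_1,\dots,v_d)$. A symmetric tensor is indexed by exponents $\alpha\in\mathbb N^{d}$, $|\alpha|\le m$: $\mathcal F_\alpha$ is the entry of $\mathcal F$ at $(i_1,\dots,i_m)$, $0\le i_k\le d$, whenever $x^\alpha=x_{i_1}\cdots x_{i_m}$ with $x_0:=1$. Let $\mathbb B_0$ be the set of the first $r$ monomials in the list $1,x_1,\dots,x_d,x_1^2,x_1x_2,\dots$ (graded lexicographic order), and $\mathbb B_1=(\mathbb B_0\cup x_1\mathbb B_0\cup\dots\cup x_d\mathbb B_0)\setminus\mathbb B_0$. For $\alpha\in\mathbb B_1$ let $A[\mathcal F,\alpha]=(\mathcal F_{\beta+\gamma})_{\gamma,\beta}$ and $b[\mathcal F,\alpha]=(\mathcal F_{\alpha+\gamma})_\gamma$,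 where $\beta\in\mathbb B_0$ and $|\gamma|\le m-|\alpha|$. For $G\in\mathbb C^{\mathbb B_0\times\mathbb B_1}$ let $M_{x_i}(G)\in\mathbb C^{\mathbb B_0\times\mathbb B_0}$ be the matrix whose column $\nu$ is the unit vector $e_{x_i\nu}$ if $x_i\nu\in\mathbb B_0$, and the column $G(:,x_i\nu)$ if $x_i\nu\in\mathbb B_1$. **Algorithm.** Input: a symmetric tensor $\mathcal F$, $r$ and $\xi$. (1) Let $G$ minimize $\sum_{\alpha\in\mathbb B_1}\|A[\mathcal F,\alpha]G(:,\alpha)-b[\mathcal F,\alpha]\|_2^2$. (2) Compute a Schur decomposition $Q^*\big(\sum_i\xi_iM_{x_i}(G)\big)Q=T$ with $Q=[q_1\ \cdots\ q_r]$ unitary and $T$ upper triangular. (3) Put $v_i^{ls}=(1,q_i^*M_{x_1}(G)q_i,\dots,q_i^*M_{x_d}(G)q_i)$ and let $\lambda^{ls}\in\mathbb C^r$ minimize $\|\sum_i\lambda_i(v_i^{ls})^{\otimes m}-\mathcal F\|^2$. (4) Put $u_i^{ls}=\sqrt[m]{\lambda_i^{ls}}\,v_i^{ls}$ and $\mathcal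 X^{gp}=\sum_i(u_i^{ls})^{\otimes m}$. (5) From the starting point $(u_i^{ls})$, compute an improved solution $(u_i^{opt})$ of $\min_u\|\sum_iu_i^{\otimes m}-\mathcal F\|^2$, i.e. one whose objective value is not larger, and put $\mathcal X^{opt}=\sum_i(u_i^{opt})^{\otimes m}$. All choices that the steps leave open are arbitrary. **Theorem.** For given $m,n,r,\xi$ there are a function $C(\mathcal F)$ of the tensor $\mathcal F$ and a positive function $\delta(\lambda,v)$ of $\lambda\in\mathbb C^r$ and $v=(v_1,\dots,v_r)\in(\mathbb C^n)^r$ such that the following holds. Let $\mathcal F$ be a symmetric tensor and let $\mathcal X^{bs}=\sum_{i=1}^r\lambda_iv_i^{\otimes m}$ with $(v_1)_0=\dots=(v_r)_0=1$ and $\varepsilon=\|\mathcal F-\mathcal X^{bs}\|$ (for instance a best or almost best rank-$r$ approximation of $\mathcal F$). Assume that i) the vectors $[\bar v_1]_{\mathbb B_0},\dots,[\bar v_r]_{\mathbb B_0}$ of the monomials in $\mathbb B_0$ evaluated at $\bar v_1,\dots,\bar v_r$ are linearly independent; ii) each matrix $A[\mathcal F,\alpha]$, $\alpha\in\mathbb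 B_1$, has full column rank; iii) the decomposition is scaling-optimal for $\mathcal F$, i.e. $\lambda$ minimizes $\|\sum_i\mu_iv_i^{\otimes m}-\mathcal F\|^2$ over $\mu\in\mathbb C^r$; iv) the numbers $\xi^T\bar v_1,\dots,\xi^T\bar v_r$ are pairwise distinct. If $\varepsilon<\delta(\lambda,v)$, then all tensors $\mathcal X^{gp},\mathcal X^{opt}$ produced by the algorithm satisfy $$\|\mathcal X^{bs}-\mathcal X^{gp}\|\le C(\mathcal F)\,\varepsilon,\qquad \|\mathcal F-\mathcal X^{opt}\|\le\|\mathcal F-\mathcal X^{gp}\|\le C(\mathcal F)\,\varepsilon .$$ Moreover, $C$ stays bounded as $\mathcal F$ approaches such a tensor: if $(v_i)_0=1$ for all $i$, i) and iv) hold for $v$, and all matrices $A[\mathcal X,\alpha]$ of $\mathcal X=\sum_i\lambda_iv_i^{\otimes m}$ have full column rank, then $C$ is bounded above on a neighbourhood of $\mathcal X$. -/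

import Mathlib

namespace GenPoly

/-! Tensors of order `m` on `ℂ^n` with the Hilbert-Schmidt (entrywise Euclidean) norm. -/

/-- `m`-tensors with all dimensions equal to `n`; the norm is `(∑ |F_{i_1 ... i_m}|^2)^{1/2}`. -/
abbrev Tensor (m n : ℕ) : Type := EuclideanSpace ℂ (Fin m → Fin n)

/-- A tensor is symmetric if its entries are invariant under permutations of the indices. -/
def IsSymmetric {m n : ℕ} (F : Tensor m n) : Prop :=
  ∀ (σ : Equiv.Perm (Fin m)) (i : Fin m → Fin n), F (fun k => i (σ k)) = F i

/-- The rank-one tensor `v^{⊗m}`. -/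
noncomputable def tpow (m : ℕ) {n : ℕ} (v : Fin n → ℂ) : Tensor m n :=
  WithLp.toLp 2 (fun i => ∏ k, v (i k))

/-- The tensor `∑ i, lam i • (v i)^{⊗m}`. -/
noncomputable def weightedSum (m : ℕ) {n r : ℕ} (lam : Fin r → ℂ) (v : Fin r → Fin n → ℂ) :
    Tensor m n :=
  ∑ i, lam i • tpow m (v i)

/-- The tensor `∑ i, (u i)^{⊗m}`. -/
noncomputable def powerSum (m : ℕ) {n r : ℕ} (u : Fin r → Fin n → ℂ) : Tensor m n :=
  ∑ i, tpow m (u i)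

/-- `lam` solves the linear least squares problem
`min ‖lam_1 v_1^{⊗m} + ... + lam_r v_r^{⊗m} - F‖^2` for the given vectors `v`. -/
def IsOptimalScaling {m n r : ℕ} (F : Tensor m n) (v : Fin r → Fin n → ℂ) (lam : Fin r → ℂ) :
    Prop :=
  ∀ mu : Fin r → ℂ, ‖weightedSum m lam v - F‖ ^ 2 ≤ ‖weightedSum m mu v - F‖ ^ 2

/-! Monomials `x^α` in the `d = n - 1` variables `x_1, ..., x_d`, written as exponent vectors. -/

/-- Exponent vectors; the variable `x_{j+1}` corresponds to `j : Fin d`. -/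
abbrev Mon (d : ℕ) : Type := Fin d → ℕ

/-- The total degree `|α|`. -/
def deg {d : ℕ} (α : Mon d) : ℕ := ∑ j, α j

/-- The exponent vector of `x_{i_1} ... x_{i_m}` with `x_0 = 1`. -/
def expo {m d : ℕ} (i : Fin m → Fin (d + 1)) : Mon d :=
  fun j => (Finset.univ.filter fun k => i k = j.succ).card

open Classical in
/-- The entry `F_α = F_{i_1 ... i_m}` of a symmetric tensor, for any `i` with
`x^α = x_{i_1} ... x_{i_m}`, `x_0 = 1`. Such an `i` exists exactly when `|α| ≤ m`; the value for
other `α` is irrelevant. -/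
noncomputable def entry {m d : ℕ} (F : Tensor m (d + 1)) (α : Mon d) : ℂ :=
  if h : ∃ i : Fin m → Fin (d + 1), expo i = α then F h.choose else 0

/-- Well-definedness of the monomial indexing. -/
theorem entry_expo {m d : ℕ} {F : Tensor m (d + 1)} (hF : IsSymmetric F)
    (i : Fin m → Fin (d + 1)) : entry F (expo i) = F i := by
  classical
  have h : ∃ i' : Fin m → Fin (d + 1), expo i' = expo i := ⟨i, rfl⟩
  unfold entry
  rw [dif_pos h]
  generalize hi' : h.choose = i'
  have hex : expo i' = expo i := hi' ▸ h.choose_spec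
  have hs : ∀ j : Fin d, (Finset.univ.filter fun k => i' k = j.succ).card
      = (Finset.univ.filter fun k => i k = j.succ).card := fun j => congrFun hex j
  have tot : ∀ f : Fin m → Fin (d + 1), (Finset.univ.filter fun k => f k = 0).card
      + ∑ j : Fin d, (Finset.univ.filter fun k => f k = j.succ).card = m := by
    intro f
    have := Finset.card_eq_sum_card_fiberwise (f := f) (s := Finset.univ) (t := Finset.univ)
      (by intro x _; simp)
    rw [Fin.sum_univ_succ] at this
    simpa using this.symm
  have hall : ∀ c : Fin (d + 1), (Finset.univ.filter fun k => i k = c).card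
      = (Finset.univ.filter fun k => i' k = c).card := by
    intro c
    refine Fin.cases ?_ (fun j => (hs j).symm) c
    have h1 := tot i
    have h2 := tot i'
    have h3 := Finset.sum_congr (rfl : (Finset.univ : Finset (Fin d)) = Finset.univ)
      (fun j _ => hs j)
    omega
  let e : ∀ c : Fin (d + 1), {k // i k = c} ≃ {k // i' k = c} := fun c =>
    Fintype.equivOfCardEq (by rw [Fintype.card_subtype, Fintype.card_subtype]; exact hall c)
  have hσ : ∀ k, i' (Equiv.ofFiberEquiv e k) = i k := fun k => Equiv.ofFiberEquiv_map e k
  have := hF (Equiv.ofFiberEquiv e) i'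
  rw [← this]
  exact congrArg F (funext hσ)

/-- All monomials of degree at most `k`. -/
def monLE (d k : ℕ) : Finset (Mon d) :=
  (Fintype.piFinset fun _ => Finset.range (k + 1)).filter fun α => deg α ≤ k

theorem mem_monLE {d k : ℕ} {α : Mon d} : α ∈ monLE d k ↔ deg α ≤ k := by
  unfold monLE
  rw [Finset.mem_filter, Fintype.mem_piFinset]
  refine ⟨fun h => h.2, fun h => ⟨fun j => ?_, h⟩⟩
  have : α j ≤ deg α := Finset.single_le_sum (fun _ _ => Nat.zero_le _) (Finset.mem_univ j)
  rw [Finset.mem_range]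
  omega

/-- `x^α` comes strictly before `x^β` in the graded lexicographic listing
`1, x_1, ..., x_d, x_1^2, x_1 x_2, ...`. -/
def Precedes {d : ℕ} (α β : Mon d) : Prop :=
  deg α < deg β ∨ (deg α = deg β ∧ ∃ j, (∀ k, k < j → α k = β k) ∧ β j < α j)

instance {d : ℕ} (α β : Mon d) : Decidable (Precedes α β) := by
  unfold Precedes; infer_instance

/-- The number of monomials that come before `x^α`. -/
def position {d : ℕ} (α : Mon d) : ℕ :=
  ((monLE d (deg α)).filter fun β => Precedes β α).card

/-- The set `𝔹₀` of the first `r` monomials. -/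
def B0 (d r : ℕ) : Finset (Mon d) := (monLE d r).filter fun α => position α < r

theorem deg_le_position {d : ℕ} (α : Mon d) : deg α ≤ position α := by
  rcases Nat.eq_zero_or_pos d with rfl | hd
  · simp [deg]
  · let j : Fin d := ⟨0, hd⟩
    have hdeg : ∀ k, deg (Pi.single j k : Mon d) = k := by
      intro k
      simp [deg]
    have hinj : Function.Injective (fun k : ℕ => (Pi.single j k : Mon d)) :=
      fun a b hab => by simpa using congrFun hab j
    have hsub : (Finset.range (deg α)).image (fun k : ℕ => (Pi.single j k : Mon d))
        ⊆ (monLE d (deg α)).filter fun β => Precedes β α := by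
      intro β hβ
      obtain ⟨k, hk, rfl⟩ := Finset.mem_image.1 hβ
      have hk' := Finset.mem_range.1 hk
      refine Finset.mem_filter.2 ⟨mem_monLE.2 ?_, Or.inl ?_⟩
      · rw [hdeg]; omega
      · rw [hdeg]; exact hk'
    have := Finset.card_le_card hsub
    rwa [Finset.card_image_of_injective _ hinj, Finset.card_range] at this

/-- `𝔹₀` consists of all monomials preceded by fewer than `r` monomials. -/
theorem mem_B0 {d r : ℕ} {α : Mon d} : α ∈ B0 d r ↔ position α < r := by
  unfold B0
  rw [Finset.mem_filter, mem_monLE]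
  have := deg_le_position α
  exact ⟨fun h => h.2, fun h => ⟨by omega, h⟩⟩

/-- The exponent vector of `x_i x^ν`. -/
def mulVar {d : ℕ} (i : Fin d) (ν : Mon d) : Mon d := ν + Pi.single i 1

/-- The set `𝔹₁ = (𝔹₀ ∪ x_1 𝔹₀ ∪ ... ∪ x_d 𝔹₀) \ 𝔹₀`. -/
def B1 (d r : ℕ) : Finset (Mon d) :=
  (B0 d r ∪ Finset.univ.biUnion fun i => (B0 d r).image (mulVar i)) \ B0 d r

theorem mulVar_mem_B1 {d r : ℕ} {i : Fin d} {ν : Mon d} (hν : ν ∈ B0 d r)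
    (h : mulVar i ν ∉ B0 d r) : mulVar i ν ∈ B1 d r := by
  unfold B1
  refine Finset.mem_sdiff.2 ⟨Finset.mem_union_right _ ?_, h⟩
  exact Finset.mem_biUnion.2 ⟨i, Finset.mem_univ i, Finset.mem_image_of_mem _ hν⟩

/-- The exponents `γ` with `|γ| ≤ m - |α|` (none if `|α| > m`). -/
def rowSet (m : ℕ) {d : ℕ} (α : Mon d) : Finset (Mon d) :=
  (monLE d m).filter fun γ => deg γ + deg α ≤ m

/-- The matrix `A[F, α]`, with entries `F_{β+γ}`. -/
noncomputable def matA {m d : ℕ} (r : ℕ) (F : Tensor m (d + 1)) (α : Mon d) :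
    Matrix (rowSet m α) (B0 d r) ℂ :=
  fun γ β => entry F (β.1 + γ.1)

/-- The vector `b[F, α]`, with entries `F_{α+γ}`. -/
noncomputable def vecb {m d : ℕ} (F : Tensor m (d + 1)) (α : Mon d) : rowSet m α → ℂ :=
  fun γ => entry F (α + γ.1)

/-- All the matrices `A[F, α]`, `α ∈ 𝔹₁`, have full column rank. -/
def FullColumnRank {m d : ℕ} (r : ℕ) (F : Tensor m (d + 1)) : Prop :=
  ∀ α ∈ B1 d r, (matA r F α).rank = Fintype.card (B0 d r)

/-- The objective `∑_{α ∈ 𝔹₁} ‖A[F, α] G(:, α) - b[F, α]‖₂²`. -/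
noncomputable def genObjective {m d r : ℕ} (F : Tensor m (d + 1))
    (G : Matrix (B0 d r) (B1 d r) ℂ) : ℝ :=
  ∑ α : B1 d r, ∑ γ : rowSet m α.1,
    ‖((matA r F α.1).mulVec (fun β => G β α) - vecb F α.1) γ‖ ^ 2

/-- The matrix `M_{x_i}(G)`. -/
def multMatrix {d r : ℕ} (i : Fin d) (G : Matrix (B0 d r) (B1 d r) ℂ) :
    Matrix (B0 d r) (B0 d r) ℂ :=
  fun μ ν =>
    if h : mulVar i ν.1 ∈ B0 d r then (if μ.1 = mulVar i ν.1 then 1 else 0)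
    else G μ ⟨mulVar i ν.1, mulVar_mem_B1 ν.2 h⟩

/-- `M(ξ, G) = ξ_1 M_{x_1}(G) + ... + ξ_d M_{x_d}(G)`. -/
noncomputable def combMatrix {d r : ℕ} (ξ : Fin d → ℝ) (G : Matrix (B0 d r) (B1 d r) ℂ) :
    Matrix (B0 d r) (B0 d r) ℂ :=
  ∑ i, (ξ i : ℂ) • multMatrix i G

/-- The objective `‖u_1^{⊗m} + ... + u_r^{⊗m} - F‖²` of the nonlinear least squares problem. -/
noncomputable def lsObjective {m n r : ℕ} (F : Tensor m n) (u : Fin r → Fin n → ℂ) : ℝ :=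
  ‖powerSum m u - F‖ ^ 2

/-- `(Xgp, Xopt)` is a possible output of the generating polynomial algorithm for rank-`r`
approximation, with input `F`, `r` and the weights `ξ`. All choices left open by the algorithm
(the least squares minimizers, the Schur decomposition, the `m`-th roots, the improved solution)
are arbitrary. -/
def IsOutput {m d : ℕ} (r : ℕ) (ξ : Fin d → ℝ) (F Xgp Xopt : Tensor m (d + 1)) : Prop :=
  ∃ (G : Matrix (B0 d r) (B1 d r) ℂ) (Q : Matrix (B0 d r) (Fin r) ℂ)
    (T : Matrix (Fin r) (Fin r) ℂ) (v : Fin r → Fin (d + 1) → ℂ) (lam : Fin r → ℂ)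
    (u uopt : Fin r → Fin (d + 1) → ℂ),
    -- Step 1: linear least squares for `G`
    (∀ G' : Matrix (B0 d r) (B1 d r) ℂ, genObjective F G ≤ genObjective F G') ∧
    -- Step 2: Schur decomposition `Q* M(ξ, G) Q = T`
    (Q.conjTranspose * Q = 1 ∧ Q * Q.conjTranspose = 1) ∧
    Q.conjTranspose * combMatrix ξ G * Q = T ∧
    (∀ i j, j < i → T i j = 0) ∧
    -- Step 3: `v_i = (1, q_i* M_{x_1} q_i, ..., q_i* M_{x_d} q_i)`, linear least squares for `lam`
    (∀ i, v i = Fin.cons 1 (fun j => (Q.conjTranspose * multMatrix j G * Q) i i)) ∧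
    IsOptimalScaling F v lam ∧
    -- Step 4: `u_i = lam_i^{1/m} v_i` and `Xgp = ∑ u_i^{⊗m}`
    (∀ i, ∃ w : ℂ, w ^ m = lam i ∧ u i = w • v i) ∧
    Xgp = powerSum m u ∧
    -- Step 5: improve the starting point `u` in the nonlinear least squares problem
    lsObjective F uopt ≤ lsObjective F u ∧
    Xopt = powerSum m uopt

/-- The vectors `[v̄_1]_{𝔹₀}, ..., [v̄_r]_{𝔹₀}` of monomials in `𝔹₀` evaluated at the points
`v̄_i = ((v_i)_1, ..., (v_i)_d)` are linearly independent. -/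
def MonomialsIndependent {d r : ℕ} (v : Fin r → Fin (d + 1) → ℂ) : Prop :=
  LinearIndependent ℂ (fun (i : Fin r) (β : B0 d r) => ∏ j : Fin d, v i j.succ ^ β.1 j)

/-- The numbers `ξᵀ v̄_1, ..., ξᵀ v̄_r` are pairwise distinct. -/
def SeparatedBy {d r : ℕ} (ξ : Fin d → ℝ) (v : Fin r → Fin (d + 1) → ℂ) : Prop :=
  Function.Injective (fun i : Fin r => ∑ j : Fin d, (ξ j : ℂ) * v i j.succ)

end GenPoly

namespace GenPoly

/-! Perturbation estimates that are uniform on bounded sets. -/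

/-! The entries of an exact decomposition are moments `∑ i, lam i * monEval (v i) α`. By
independence on `B0`, some `G'` interpolates the `B1` monomials at the points, and it solves the
equations of step 1 exactly (`genOperator_eq_genRhs`). Full column rank makes this linear problem
stable, so the least squares solution `G` for `F` satisfies `‖G - G'‖ = O(ε)`
(`exists_least_squares_bound`). The matrices `multMatrix j G'` share the left eigenvectors
`[v̄_i]_{𝔹₀}`, with the coordinates of the points as eigenvalues (`evalMatrix_mul_multMatrix`). The
separated eigenvalues of the `ξ`-combination move by `O(ε)` (`exists_eigenvalue_bound`). No
eigenvector perturbation is needed for the other coordinates: interpolation at separated nodes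
writes `multMatrix j G'` as a polynomial in the `ξ`-combination, and the diagonal of a polynomial in
a triangular matrix is the polynomial of its diagonal (`exists_diagonal_bound`). Hence the computed
points are `O(ε)`-close to the given ones up to a permutation. The permuted old coefficients then
have residual `O(ε)`, and the optimal ones do no worse.

The constant may depend on `F` only, although many decompositions can approximate `F`. So
`exists_local_bound` is uniform over all decompositions of tensors near a good one: points,
separation and coefficients are controlled through the tensor and its generating matrix alone
(`exists_points_bound`, `exists_coeff_bound`). `C F` is then the infimum of the admissible constants
plus `2`. Large `ε` is harmless because `‖F - Xgp‖ ≤ ‖F‖`. -/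

theorem exists_lipschitz_on_bounded {E F : Type*} [NormedAddCommGroup E] [NormedSpace ℂ E]
    [FiniteDimensional ℂ E] [NormedAddCommGroup F] [NormedSpace ℂ F] {f : E → F}
    (hf : ContDiff ℂ 1 f) (R : ℝ) :
    ∃ K : ℝ, 0 ≤ K ∧ ∀ x y, ‖x‖ ≤ R → ‖y‖ ≤ R → ‖f x - f y‖ ≤ K * ‖x - y‖ := by
  let _ : NormedSpace ℝ E := NormedSpace.restrictScalars ℝ ℂ E
  have : ProperSpace E := FiniteDimensional.proper ℂ E
  obtain ⟨C, hC⟩ := (isCompact_closedBall (0 : E) R).exists_bound_of_continuousOn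
    (hf.continuous_fderiv one_ne_zero).continuousOn
  refine ⟨max C 0, le_max_right _ _, fun x y hx hy => ?_⟩
  refine Convex.norm_image_sub_le_of_norm_fderiv_le (𝕜 := ℂ) (s := Metric.closedBall (0 : E) R)
    (fun z _ => (hf.differentiable one_ne_zero) z) (fun z hz => (hC z hz).trans (le_max_left _ _))
    (convex_closedBall _ _) ?_ ?_
  · simpa using hy
  · simpa using hx

/-- If the monic polynomial with roots `t` is small at the separated points `θ`, then its roots
are near these points. -/
theorem exists_perm_near {n : Type*} [Fintype n] [DecidableEq n] {θ t : n → ℂ} {s e : ℝ}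
    (hs : 0 < s) (hsep : ∀ i j, i ≠ j → s ≤ ‖θ i - θ j‖) (he : e < (s / 4) ^ Fintype.card n)
    (h : ∀ k, ∏ i, ‖θ k - t i‖ ≤ e) :
    ∃ τ : Equiv.Perm n, ∀ k, ‖θ k - t (τ k)‖ ≤ s / 4 ∧
      ‖θ k - t (τ k)‖ * (s / 2) ^ (Fintype.card n - 1) ≤ e := by
  -- Otherwise every factor exceeds `s / 4` and the product is too large.
  have h1 : ∀ k, ∃ i, ‖θ k - t i‖ ≤ s / 4 := by
    intro k
    by_contra! hcon
    have : ∏ _i : n, (s / 4) ≤ ∏ i, ‖θ k - t i‖ :=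
      Finset.prod_le_prod (fun _ _ => by positivity) (fun i _ => (hcon i).le)
    rw [Finset.prod_const, Finset.card_univ] at this
    linarith [h k]
  choose τ hτ using h1
  have tri : ∀ k l i, s ≤ ‖θ k - θ l‖ → ‖θ l - t i‖ ≤ s / 4 → s / 2 < ‖θ k - t i‖ := by
    intro k l i hkl hi
    have := norm_sub_le_norm_sub_add_norm_sub (θ k) (t i) (θ l)
    rw [norm_sub_rev (t i)] at this
    linarith
  have hinj : Function.Injective τ := by
    intro k l hkl
    by_contra hne
    have := tri k l (τ l) (hsep k l hne) (hτ l)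
    rw [← hkl] at this
    linarith [hτ k]
  let σ : Equiv.Perm n := Equiv.ofBijective τ (Finite.injective_iff_bijective.1 hinj)
  refine ⟨σ, fun k => ⟨hτ k, ?_⟩⟩
  refine le_trans ?_ (h k)
  rw [← Finset.mul_prod_erase _ _ (Finset.mem_univ (σ k))]
  refine mul_le_mul_of_nonneg_left ?_ (norm_nonneg _)
  -- Every other root is matched to another `θ l`, so it lies at distance more than `s - s / 4 > s /
  -- 2` from `θ k`.
  have : ∏ _i ∈ Finset.univ.erase (σ k), (s / 2)
      ≤ ∏ i ∈ Finset.univ.erase (σ k), ‖θ k - t i‖ := by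
    refine Finset.prod_le_prod (fun _ _ => by positivity) (fun i hi => ?_)
    obtain ⟨l, rfl⟩ := σ.surjective i
    have hlk : l ≠ k := fun hl => (Finset.mem_erase.1 hi).1 (by rw [hl])
    exact (tri k l _ (hsep k l hlk.symm) (hτ l)).le
  rwa [Finset.prod_const, Finset.card_erase_of_mem (Finset.mem_univ _), Finset.card_univ] at this

/-- A bound for eigenvalues in terms of the entries. -/
theorem norm_le_of_vecMul_eq_smul {n : Type*} [Fintype n] {N : Matrix n n ℂ} {w : n → ℂ} {t : ℂ}
    {R : ℝ} (hw : w ≠ 0) (h : Matrix.vecMul w N = t • w) (hN : ∀ a b, ‖N a b‖ ≤ R) :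
    ‖t‖ ≤ Fintype.card n * R := by
  obtain ⟨c, hc⟩ := Function.ne_iff.1 hw
  obtain ⟨b, -, hb⟩ := Finset.exists_max_image Finset.univ (fun b => ‖w b‖) ⟨c, Finset.mem_univ c⟩
  have hpos : 0 < ‖w b‖ := (norm_pos_iff.2 hc).trans_le (hb c (Finset.mem_univ c))
  have h1 : ∑ a, w a * N a b = t * w b := congrFun h b
  have h2 : ‖t‖ * ‖w b‖ ≤ ∑ _a : n, ‖w b‖ * R := by
    rw [← norm_mul, ← h1]
    refine (norm_sum_le _ _).trans (Finset.sum_le_sum fun a _ => ?_)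
    rw [norm_mul]
    exact mul_le_mul (hb a (Finset.mem_univ a)) (hN a b) (norm_nonneg _) (norm_nonneg _)
  rw [Finset.sum_const, Finset.card_univ, nsmul_eq_mul] at h2
  refine le_of_mul_le_mul_right ?_ hpos
  linarith

/-- Separation is a closed condition, so bounded separated nodes form a compact set, on which the
determinant does not vanish and the inverse is continuous. -/
theorem exists_bound_vandermonde_inv (r : ℕ) (R : ℝ) {s : ℝ} (hs : 0 < s) :
    ∃ B : ℝ, 0 ≤ B ∧ ∀ θ : Fin r → ℂ, ‖θ‖ ≤ R → (∀ i j, i ≠ j → s ≤ ‖θ i - θ j‖) →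
      IsUnit (Matrix.vandermonde θ).det ∧ ∀ a b, ‖(Matrix.vandermonde θ)⁻¹ a b‖ ≤ B := by
  let S : Set (Fin r → ℂ) := {θ | ∀ i j, i ≠ j → s ≤ ‖θ i - θ j‖}
  have hunit : ∀ θ ∈ S, (Matrix.vandermonde θ).det ≠ 0 := by
    intro θ hθ
    rw [Matrix.det_vandermonde_ne_zero_iff]
    intro i j hij
    by_contra hne
    have := hθ i j hne
    rw [hij, sub_self, norm_zero] at this
    linarith
  have hclosed : IsClosed S := by
    simp only [S, Set.ofPred_forall]
    refine isClosed_iInter fun i => isClosed_iInter fun j => isClosed_iInter fun _ => ?_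
    exact isClosed_le continuous_const (by fun_prop)
  have hcomp : IsCompact (Metric.closedBall (0 : Fin r → ℂ) R ∩ S) :=
    (isCompact_closedBall _ _).inter_right hclosed
  have hV : Continuous fun θ : Fin r → ℂ => Matrix.vandermonde θ := by
    refine continuous_matrix fun i j => ?_
    simp only [Matrix.vandermonde_apply]
    fun_prop
  have hcont : ContinuousOn
      (fun θ : Fin r → ℂ => (fun a b => (Matrix.vandermonde θ)⁻¹ a b : Fin r → Fin r → ℂ))
      (Metric.closedBall (0 : Fin r → ℂ) R ∩ S) := by
    simp only [Matrix.inv_def, Ring.inverse_eq_inv', Matrix.smul_apply, smul_eq_mul]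
    refine continuousOn_pi.2 fun a => continuousOn_pi.2 fun b => ?_
    refine ContinuousOn.mul ?_ ?_
    · exact hV.matrix_det.continuousOn.inv₀ fun θ hθ => hunit θ hθ.2
    · exact ((continuous_id.matrix_elem a b).comp hV.matrix_adjugate).continuousOn
  obtain ⟨B, hB⟩ := hcomp.exists_bound_of_continuousOn hcont
  refine ⟨max B 0, le_max_right _ _, fun θ hR hθ => ⟨isUnit_iff_ne_zero.2 (hunit θ hθ), ?_⟩⟩
  intro a b
  have := hB θ ⟨by simpa using hR, hθ⟩
  exact ((norm_le_pi_norm _ b).trans (norm_le_pi_norm _ a)).trans (this.trans (le_max_left _ _))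

theorem pi_norm_le_of_entries {m n : Type*} [Fintype m] [Fintype n] {f : m → n → ℂ} {R : ℝ}
    (hR : 0 ≤ R) (h : ∀ a b, ‖f a b‖ ≤ R) : ‖f‖ ≤ R :=
  (pi_norm_le_iff_of_nonneg hR).2 fun a => (pi_norm_le_iff_of_nonneg hR).2 (h a)

theorem norm_apply_le_pi_norm {l m n : Type*} [Fintype l] [Fintype m] [Fintype n]
    (f : l → m → n → ℂ) (k : l) (a : m) (b : n) : ‖f k a b‖ ≤ ‖f‖ :=
  (norm_le_pi_norm (f k a) b).trans ((norm_le_pi_norm (f k) a).trans (norm_le_pi_norm f k))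

/-- The determinant is polynomial in `z` and the entries, hence Lipschitz on bounded sets. -/
theorem exists_charpoly_lipschitz (r : ℕ) {R : ℝ} (hR : 0 ≤ R) :
    ∃ K : ℝ, 0 ≤ K ∧ ∀ (z : ℂ) (N N' : Matrix (Fin r) (Fin r) ℂ) (e : ℝ), 0 ≤ e → ‖z‖ ≤ R →
      (∀ a b, ‖N a b‖ ≤ R) → (∀ a b, ‖N' a b‖ ≤ R) → (∀ a b, ‖N a b - N' a b‖ ≤ e) →
      ‖(z • (1 : Matrix (Fin r) (Fin r) ℂ) - N).det - (z • (1 : Matrix (Fin r) (Fin r) ℂ) - N').det‖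
        ≤ K * e := by
  have hf : ContDiff ℂ 1 fun p : ℂ × (Fin r → Fin r → ℂ) =>
      (p.1 • (1 : Matrix (Fin r) (Fin r) ℂ) - Matrix.of p.2).det := by
    simp only [Matrix.det_apply', Matrix.sub_apply, Matrix.smul_apply, Matrix.of_apply]
    fun_prop
  obtain ⟨K, hK, h⟩ := exists_lipschitz_on_bounded hf R
  refine ⟨K, hK, fun z N N' e he hz hN hN' hd => ?_⟩
  refine (h (z, fun a b => N a b) (z, fun a b => N' a b) ?_ ?_).trans
    (mul_le_mul_of_nonneg_left ?_ hK)
  · exact max_le hz (pi_norm_le_of_entries hR hN)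
  · exact max_le hz (pi_norm_le_of_entries hR hN')
  · refine max_le ?_ (pi_norm_le_of_entries he hd)
    simpa using he

theorem exists_pow_lipschitz (r : ℕ) {R : ℝ} (hR : 0 ≤ R) :
    ∃ K : ℝ, 0 ≤ K ∧ ∀ (N N' : Matrix (Fin r) (Fin r) ℂ) (e : ℝ), 0 ≤ e →
      (∀ a b, ‖N a b‖ ≤ R) → (∀ a b, ‖N' a b‖ ≤ R) → (∀ a b, ‖N a b - N' a b‖ ≤ e) →
      ∀ (k : Fin r) (a b : Fin r), ‖(N ^ (k : ℕ)) a b - (N' ^ (k : ℕ)) a b‖ ≤ K * e := by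
  have hp : ∀ (k : ℕ) (a b : Fin r), ContDiff ℂ 1 fun p : Fin r → Fin r → ℂ =>
      (Matrix.of p ^ k) a b := by
    intro k
    induction k with
    | zero => intro a b; simp only [pow_zero]; fun_prop
    | succ k ih =>
      intro a b
      simp only [pow_succ, Matrix.mul_apply, Matrix.of_apply]
      exact ContDiff.sum fun l _ => (ih a l).mul (contDiff_apply_apply ℂ ℂ l b)
  have hf : ContDiff ℂ 1 fun (p : Fin r → Fin r → ℂ) (k a b : Fin r) =>
      (Matrix.of p ^ (k : ℕ)) a b :=
    contDiff_pi.2 fun k => contDiff_pi.2 fun a => contDiff_pi.2 fun b => hp k a b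
  obtain ⟨K, hK, h⟩ := exists_lipschitz_on_bounded hf R
  refine ⟨K, hK, fun N N' e he hN hN' hd k a b => ?_⟩
  have h1 := (h (fun a b => N a b) (fun a b => N' a b) (pi_norm_le_of_entries hR hN)
    (pi_norm_le_of_entries hR hN')).trans
      (mul_le_mul_of_nonneg_left (pi_norm_le_of_entries he hd) hK)
  exact (norm_apply_le_pi_norm _ k a b).trans h1

/-- The eigenvalues of an upper triangular matrix near a matrix with separated eigenvalues `θ`,
the determinants `det (θ k - N)` being zero. -/
theorem exists_eigenvalue_bound (r : ℕ) {R s : ℝ} (hR : 0 ≤ R) (hs : 0 < s) :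
    ∃ K η : ℝ, 0 ≤ K ∧ 0 < η ∧ ∀ (N P : Matrix (Fin r) (Fin r) ℂ) (θ t : Fin r → ℂ) (e : ℝ),
      (∀ a b, ‖N a b‖ ≤ R) → (∀ a b, ‖P a b‖ ≤ R) → (∀ k, ‖θ k‖ ≤ R) →
      (∀ i j, i ≠ j → s ≤ ‖θ i - θ j‖) →
      (∀ k, (θ k • (1 : Matrix (Fin r) (Fin r) ℂ) - N).det = 0) →
      (∀ z : ℂ, (z • (1 : Matrix (Fin r) (Fin r) ℂ) - P).det = ∏ i, (z - t i)) →
      0 ≤ e → e ≤ η → (∀ a b, ‖P a b - N a b‖ ≤ e) →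
      ∃ τ : Equiv.Perm (Fin r), ∀ k, ‖θ k - t (τ k)‖ ≤ s / 4 ∧ ‖θ k - t (τ k)‖ ≤ K * e := by
  obtain ⟨L, hL, hlip⟩ := exists_charpoly_lipschitz r hR
  -- `L * e` bounds the product of the distances to the roots, and `r - 1` of its factors are at
  -- least `s / 2`. The threshold forces `L * e < (s / 4) ^ r`; `L + 1` avoids division by zero.
  refine ⟨L / (s / 2) ^ (r - 1), (s / 4) ^ r / (2 * (L + 1)), by positivity, by positivity, ?_⟩
  intro N P θ t e hN hP hθ hsep hdet hchar he heη hd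
  have hprod : ∀ k, ∏ i, ‖θ k - t i‖ ≤ L * e := by
    intro k
    have := hlip (θ k) P N e he (hθ k) hP hN hd
    rwa [hdet k, hchar, sub_zero, norm_prod] at this
  have hlt : L * e < (s / 4) ^ Fintype.card (Fin r) := by
    rw [Fintype.card_fin]
    have h1 : (L + 1) * e ≤ (s / 4) ^ r / 2 := by
      have := mul_le_mul_of_nonneg_left heη (by positivity : 0 ≤ L + 1)
      refine this.trans (le_of_eq ?_)
      field_simp
    have h2 : 0 < (s / 4) ^ r := by positivity
    nlinarith
  obtain ⟨τ, hτ⟩ := exists_perm_near hs hsep hlt hprod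
  refine ⟨τ, fun k => ⟨(hτ k).1, ?_⟩⟩
  have := (hτ k).2
  rw [Fintype.card_fin] at this
  rw [div_mul_eq_mul_div, le_div_iff₀ (by positivity)]
  exact this

theorem vecMul_row_eq_smul {n : Type*} [Fintype n] [DecidableEq n] {W N : Matrix n n ℂ}
    {θ : n → ℂ} (h : W * N = Matrix.diagonal θ * W) (k : n) :
    Matrix.vecMul (W k) N = θ k • W k := by
  ext b
  have := congrFun (congrFun h k) b
  rwa [Matrix.diagonal_mul] at this

theorem det_smul_one_sub_of_diagonalized {n : Type*} [Fintype n] [DecidableEq n]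
    {W N : Matrix n n ℂ} {θ : n → ℂ} (hW : IsUnit W) (h : W * N = Matrix.diagonal θ * W) (z : ℂ) :
    (z • (1 : Matrix n n ℂ) - N).det = ∏ i, (z - θ i) := by
  have h1 : W * (z • (1 : Matrix n n ℂ) - N) = Matrix.diagonal (fun i => z - θ i) * W := by
    rw [mul_sub, h, mul_smul_comm, mul_one]
    ext a b
    simp [Matrix.diagonal_mul, sub_mul]
  have h2 := congrArg Matrix.det h1
  rw [Matrix.det_mul, Matrix.det_mul, Matrix.det_diagonal, mul_comm] at h2
  exact mul_right_cancel₀ ((Matrix.isUnit_iff_isUnit_det W).1 hW).ne_zero h2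

theorem pow_apply_of_lower_zero {r : ℕ} {T : Matrix (Fin r) (Fin r) ℂ}
    (hT : ∀ i j, j < i → T i j = 0) (k : ℕ) (i : Fin r) :
    (∀ j, j < i → (T ^ k) i j = 0) ∧ (T ^ k) i i = T i i ^ k := by
  induction k generalizing i with
  | zero => exact ⟨fun j hj => by simp [hj.ne'], by simp⟩
  | succ k ih =>
    constructor
    · intro j hj
      rw [pow_succ, Matrix.mul_apply]
      refine Finset.sum_eq_zero fun l _ => ?_
      rcases lt_or_ge l i with hl | hl
      · rw [(ih i).1 l hl, zero_mul]
      · rw [hT l j (hj.trans_le hl), mul_zero]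
    · rw [pow_succ, Matrix.mul_apply, Finset.sum_eq_single i]
      · rw [(ih i).2, pow_succ]
      · intro l _ hl
        rcases lt_or_gt_of_ne hl with hl | hl
        · rw [(ih i).1 l hl, zero_mul]
        · rw [hT l i hl, mul_zero]
      · simp

/-- If `M'` and `P'` have the common left eigenvectors `W`, the eigenvalues `θ` of `P'` being
separated, then the diagonal of a perturbation `M` of `M'` is close to the eigenvalues `x` of
`M'`, provided that the perturbation `T` of `P'` is upper triangular. -/
theorem exists_diagonal_bound (r : ℕ) {R s : ℝ} (hR : 0 ≤ R) (hs : 0 < s) :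
    ∃ K : ℝ, 0 ≤ K ∧ ∀ (T P' M M' W : Matrix (Fin r) (Fin r) ℂ) (θ x : Fin r → ℂ) (e : ℝ),
      (∀ a b, ‖T a b‖ ≤ R) → (∀ a b, ‖P' a b‖ ≤ R) → (∀ k, ‖θ k‖ ≤ R) → (∀ k, ‖x k‖ ≤ R) →
      (∀ i j, i ≠ j → s ≤ ‖θ i - θ j‖) → IsUnit W →
      W * P' = Matrix.diagonal θ * W → W * M' = Matrix.diagonal x * W →
      (∀ i j, j < i → T i j = 0) → 0 ≤ e →
      (∀ a b, ‖T a b - P' a b‖ ≤ e) → (∀ a b, ‖M a b - M' a b‖ ≤ e) →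
      ∀ i k, ‖T i i - θ k‖ ≤ e → ‖M i i - x k‖ ≤ K * e := by
  obtain ⟨B, hB, hvan⟩ := exists_bound_vandermonde_inv r R hs
  obtain ⟨L, hL, hpow⟩ := exists_pow_lipschitz r hR
  refine ⟨1 + r * (r * B * R) * (2 * L), by positivity, ?_⟩
  intro T P' M M' W θ x e hT hP' hθ hx hsep hW hWP hWM hup he hTP hMM i k hik
  obtain ⟨hunit, hinv⟩ := hvan θ ((pi_norm_le_iff_of_nonneg hR).2 hθ) hsep
  -- Coefficients of the polynomial `p` of degree below `r` with `p (θ k) = x k`. They are bounded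
  -- because the nodes are separated.
  set c : Fin r → ℂ := (Matrix.vandermonde θ)⁻¹.mulVec x with hc
  have hcx : ∀ k, ∑ a : Fin r, θ k ^ (a : ℕ) * c a = x k := by
    intro k
    have : (Matrix.vandermonde θ).mulVec c = x := by
      rw [hc, Matrix.mulVec_mulVec, Matrix.mul_nonsing_inv _ hunit, Matrix.one_mulVec]
    exact congrFun this k
  have hcb : ∀ a, ‖c a‖ ≤ r * B * R := by
    intro a
    have : ‖∑ b, (Matrix.vandermonde θ)⁻¹ a b * x b‖ ≤ ∑ _b : Fin r, B * R := by
      refine (norm_sum_le _ _).trans (Finset.sum_le_sum fun b _ => ?_)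
      rw [norm_mul]
      exact mul_le_mul (hinv a b) (hx b) (norm_nonneg _) hB
    rw [Finset.sum_const, Finset.card_univ, Fintype.card_fin, nsmul_eq_mul, ← mul_assoc] at this
    exact this
  have hWpow : ∀ a : ℕ, W * P' ^ a = Matrix.diagonal (fun k => θ k ^ a) * W := by
    intro a
    induction a with
    | zero => simp
    | succ a ih =>
      rw [pow_succ, ← mul_assoc, ih, mul_assoc, hWP, ← mul_assoc, Matrix.diagonal_mul_diagonal]
      simp only [pow_succ]
  -- `M' = p(P')`: both sides act in the same way on the eigenbasis `W`, which is invertible.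
  have hM' : M' = ∑ a : Fin r, c a • P' ^ (a : ℕ) := by
    refine hW.mul_left_cancel ?_
    rw [hWM, Finset.mul_sum]
    ext k b
    simp only [mul_smul_comm, hWpow, Matrix.sum_apply, Matrix.smul_apply, Matrix.diagonal_mul,
      smul_eq_mul]
    rw [← hcx k, Finset.sum_mul]
    exact Finset.sum_congr rfl fun a _ => by ring
  -- The estimate for matrix powers is applied to scalar matrices.
  have hscalar : ∀ a : Fin r, ‖T i i ^ (a : ℕ) - θ k ^ (a : ℕ)‖ ≤ L * e := by
    intro a
    have := hpow (Matrix.diagonal fun _ => T i i) (Matrix.diagonal fun _ => θ k) e he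
      (fun a b => by
        by_cases hab : a = b
        · simpa [hab] using hT i i
        · simpa [hab] using hR)
      (fun a b => by
        by_cases hab : a = b
        · simpa [hab] using hθ k
        · simpa [hab] using hR)
      (fun a b => by
        by_cases hab : a = b
        · simpa [hab] using hik
        · simpa [hab] using he) a i i
    simpa [Matrix.diagonal_pow] using this
  -- The passage from `p(P')` to `p(θ k)` goes through `p(T)`, whose diagonal is `p(T i i)` by
  -- triangularity.
  have hsplit : M i i - x k = (M i i - M' i i)
      + ∑ a : Fin r, c a * (((T ^ (a : ℕ)) i i - θ k ^ (a : ℕ))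
        - ((T ^ (a : ℕ)) i i - (P' ^ (a : ℕ)) i i)) := by
    have h1 : M' i i = ∑ a : Fin r, c a * (P' ^ (a : ℕ)) i i := by
      rw [hM']; simp [Matrix.sum_apply]
    have h2 : x k = ∑ a : Fin r, c a * θ k ^ (a : ℕ) := by
      rw [← hcx k]; exact Finset.sum_congr rfl fun a _ => mul_comm _ _
    have h3 : ∑ a : Fin r, c a * (((T ^ (a : ℕ)) i i - θ k ^ (a : ℕ))
        - ((T ^ (a : ℕ)) i i - (P' ^ (a : ℕ)) i i)) = M' i i - x k := by
      rw [h1, h2, ← Finset.sum_sub_distrib]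
      exact Finset.sum_congr rfl fun a _ => by ring
    rw [h3]; ring
  have hsum : ‖∑ a : Fin r, c a * (((T ^ (a : ℕ)) i i - θ k ^ (a : ℕ))
        - ((T ^ (a : ℕ)) i i - (P' ^ (a : ℕ)) i i))‖ ≤ ∑ _a : Fin r, r * B * R * (2 * L * e) := by
    refine (norm_sum_le _ _).trans (Finset.sum_le_sum fun a _ => ?_)
    rw [norm_mul]
    refine mul_le_mul (hcb a) ?_ (norm_nonneg _) (by positivity)
    refine (norm_sub_le _ _).trans ?_
    have h1 := hscalar a
    have h2 := hpow T P' e he hT hP' hTP a i i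
    rw [(pow_apply_of_lower_zero hup a i).2] at h2 ⊢
    linarith
  rw [hsplit]
  refine (norm_add_le _ _).trans ((add_le_add (hMM i i) hsum).trans (le_of_eq ?_))
  rw [Finset.sum_const, Finset.card_univ, Fintype.card_fin, nsmul_eq_mul]
  ring

/-- Least squares solutions `G` of `A F G = b F` near a problem with an injective operator,
compared with exact solutions. -/
theorem exists_least_squares_bound {V U E : Type*} [NormedAddCommGroup V] [NormedSpace ℂ V]
    [NormedAddCommGroup U] [NormedSpace ℂ U] [FiniteDimensional ℂ U]
    [NormedAddCommGroup E] [NormedSpace ℂ E]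
    (A : V →L[ℂ] U →L[ℂ] E) (b : V →L[ℂ] E) (X₀ : V) (hinj : Function.Injective (A X₀)) :
    ∃ ρ K : ℝ, 0 < ρ ∧ 0 ≤ K ∧
      (∀ F, ‖F - X₀‖ ≤ ρ → Function.Injective (A F)) ∧
      ∀ F X G G', ‖F - X₀‖ ≤ ρ → ‖X - X₀‖ ≤ ρ → A X G' = b X →
        ‖A F G - b F‖ ≤ ‖A F G' - b F‖ → ‖G'‖ ≤ K ∧ ‖G - G'‖ ≤ K * ‖F - X‖ := by
  obtain ⟨κ, hκ, hanti⟩ := (A X₀ : U →ₗ[ℂ] E).exists_antilipschitzWith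
    (LinearMap.ker_eq_bot.2 hinj)
  have hlow : ∀ y, ‖y‖ ≤ κ * ‖A X₀ y‖ := fun y => by
    simpa [dist_zero_right] using hanti.le_mul_dist y 0
  have hκ' : (0 : ℝ) < κ := hκ
  -- This gives `κ * ‖A‖ * ρ ≤ 1 / 2`, so moving `X₀` by `ρ` costs at most half of the lower bound
  -- for `A X₀`.
  set ρ : ℝ := 1 / (2 * κ * (‖A‖ + 1)) with hρ
  have hρpos : 0 < ρ := by positivity
  have hlowF : ∀ F, ‖F - X₀‖ ≤ ρ → ∀ y, ‖y‖ ≤ 2 * κ * ‖A F y‖ := by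
    intro F hF y
    have h1 : ‖A (F - X₀) y‖ ≤ ‖A‖ * ρ * ‖y‖ :=
      ((A (F - X₀)).le_opNorm y).trans (mul_le_mul_of_nonneg_right
        ((A.le_opNorm _).trans (mul_le_mul_of_nonneg_left hF (norm_nonneg _))) (norm_nonneg _))
    have h2 : A X₀ y = A F y - A (F - X₀) y := by simp
    have h3 : ‖A X₀ y‖ ≤ ‖A F y‖ + ‖A‖ * ρ * ‖y‖ := by
      rw [h2]; exact (norm_sub_le _ _).trans (by linarith)
    have h4 : κ * (‖A‖ * ρ) ≤ 1 / 2 := by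
      rw [hρ]
      have : (κ : ℝ) * (‖A‖ * (1 / (2 * κ * (‖A‖ + 1)))) = (1 / 2) * (‖A‖ / (‖A‖ + 1)) := by
        field_simp
      rw [this]
      have : ‖A‖ / (‖A‖ + 1) ≤ 1 := (div_le_one (by positivity)).2 (by linarith)
      linarith
    have h5 := hlow y
    have h6 := mul_le_mul_of_nonneg_left h3 hκ'.le
    have h7 := mul_le_mul_of_nonneg_right h4 (norm_nonneg y)
    nlinarith
  set K₁ : ℝ := 2 * κ * (‖b‖ * (‖X₀‖ + ρ)) with hK₁
  have hK₁n : 0 ≤ K₁ := by positivity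
  refine ⟨ρ, max K₁ (4 * κ * (‖A‖ * K₁ + ‖b‖)), hρpos, le_max_of_le_left hK₁n, ?_, ?_⟩
  · intro F hF
    refine (injective_iff_map_eq_zero (A F)).2 fun y hy => norm_le_zero_iff.1 ?_
    have := hlowF F hF y
    rwa [hy, norm_zero, mul_zero] at this
  · intro F X G G' hF hX hex hmin
    have hG' : ‖G'‖ ≤ K₁ := by
      refine (hlowF X hX G').trans (mul_le_mul_of_nonneg_left ?_ (by positivity))
      rw [hex]
      refine (b.le_opNorm X).trans (mul_le_mul_of_nonneg_left ?_ (norm_nonneg _))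
      have := norm_le_norm_add_norm_sub' X X₀
      linarith
    refine ⟨hG'.trans (le_max_left _ _), ?_⟩
    -- Subtracting `A X G' = b X` leaves a residual that is linear in `F - X`. The minimizer `G` has
    -- no larger residual, so `A F (G - G')` is at most twice this.
    have hres : ‖A F G' - b F‖ ≤ (‖A‖ * K₁ + ‖b‖) * ‖F - X‖ := by
      have h1 : A F G' - b F = A (F - X) G' - b (F - X) := by
        simp [hex]
      rw [h1]
      refine (norm_sub_le _ _).trans ?_
      have h2 : ‖A (F - X) G'‖ ≤ ‖A‖ * ‖F - X‖ * K₁ :=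
        ((A (F - X)).le_opNorm _).trans (mul_le_mul (A.le_opNorm _) hG' (norm_nonneg _)
          (by positivity))
      have h3 := b.le_opNorm (F - X)
      nlinarith
    refine (hlowF F hF (G - G')).trans ?_
    have h4 : A F (G - G') = (A F G - b F) - (A F G' - b F) := by simp
    have h5 : ‖A F (G - G')‖ ≤ 2 * ((‖A‖ * K₁ + ‖b‖) * ‖F - X‖) := by
      rw [h4]; exact (norm_sub_le _ _).trans (by linarith)
    calc 2 * κ * ‖A F (G - G')‖ ≤ 2 * κ * (2 * ((‖A‖ * K₁ + ‖b‖) * ‖F - X‖)) :=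
          mul_le_mul_of_nonneg_left h5 (by positivity)
      _ = 4 * κ * (‖A‖ * K₁ + ‖b‖) * ‖F - X‖ := by ring
      _ ≤ _ := mul_le_mul_of_nonneg_right (le_max_right _ _) (norm_nonneg _)

/-! Monomials and tensor entries. -/

/-- The order is graded: if `α` had the smaller degree, everything before `α` would also precede
`β`. It keeps the indices `β + γ` in `matA` within degree `m`. -/
theorem deg_le_of_mem_B0 {d r : ℕ} {α β : Mon d} (hβ : β ∈ B0 d r) (hα : α ∉ B0 d r) :
    deg β ≤ deg α := by
  by_contra! hlt
  refine hα (mem_B0.2 (lt_of_le_of_lt (Finset.card_le_card fun δ hδ => ?_) (mem_B0.1 hβ)))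
  have hδ' := mem_monLE.1 (Finset.mem_filter.1 hδ).1
  exact Finset.mem_filter.2 ⟨mem_monLE.2 (by omega), Or.inl (by omega)⟩

theorem zero_mem_B0 {d r : ℕ} (hr : 1 ≤ r) : (0 : Mon d) ∈ B0 d r := by
  refine mem_B0.2 (lt_of_lt_of_le (b := 1) ?_ hr)
  rw [Nat.lt_one_iff, position, Finset.card_eq_zero, Finset.filter_eq_empty_iff]
  rintro δ - (h | ⟨h0, j, -, h⟩)
  · simp [deg] at h
  · have h1 : δ j ≤ deg δ := Finset.single_le_sum (fun _ _ => Nat.zero_le _) (Finset.mem_univ j)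
    rw [h0] at h1
    simp [deg] at h1 h
    omega

theorem deg_mulVar {d : ℕ} (i : Fin d) (ν : Mon d) : deg (mulVar i ν) = deg ν + 1 := by
  simp [deg, mulVar, Finset.sum_add_distrib]

/-- A variable times a monomial of maximal degree in `B0` leaves `B0`. -/
theorem B1_nonempty {d r : ℕ} (hd : 0 < d) (hr : 1 ≤ r) : (B1 d r).Nonempty := by
  obtain ⟨ν, hν, hmax⟩ := Finset.exists_max_image (B0 d r) deg ⟨0, zero_mem_B0 hr⟩
  refine ⟨mulVar ⟨0, hd⟩ ν, mulVar_mem_B1 hν fun h => ?_⟩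
  have := hmax _ h
  rw [deg_mulVar] at this
  omega

theorem notMem_B0_of_mem_B1 {d r : ℕ} {α : Mon d} (hα : α ∈ B1 d r) : α ∉ B0 d r :=
  (Finset.mem_sdiff.1 hα).2

theorem expo_cons {m d : ℕ} (c : Fin (d + 1)) (i : Fin m → Fin (d + 1)) (j : Fin d) :
    expo (Fin.cons c i : Fin (m + 1) → Fin (d + 1)) j
      = (if c = j.succ then 1 else 0) + expo i j := by
  simp only [expo, Finset.card_filter]
  rw [Fin.sum_univ_succ]
  simp

theorem exists_expo_eq {m d : ℕ} {α : Mon d} (h : deg α ≤ m) :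
    ∃ i : Fin m → Fin (d + 1), expo i = α := by
  induction m generalizing α with
  | zero =>
    refine ⟨Fin.elim0, funext fun j => ?_⟩
    have : α j ≤ deg α := Finset.single_le_sum (fun _ _ => Nat.zero_le _) (Finset.mem_univ j)
    simp [expo]
    omega
  | succ m ih =>
    by_cases h0 : α = 0
    · refine ⟨fun _ => 0, funext fun j => ?_⟩
      simp [expo, h0, (Fin.succ_ne_zero j).symm]
    · obtain ⟨j, hj⟩ := Function.ne_iff.1 h0
      have hα : mulVar j (α - Pi.single j 1) = α := by
        ext k
        by_cases hk : k = j
        · subst hk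
          simp only [mulVar, Pi.add_apply, Pi.sub_apply, Pi.single_eq_same]
          simp at hj
          omega
        · simp [mulVar, hk]
      have hdeg := deg_mulVar j (α - Pi.single j 1)
      rw [hα] at hdeg
      obtain ⟨i, hi⟩ := ih (α := α - Pi.single j 1) (by omega)
      refine ⟨Fin.cons j.succ i, funext fun k => ?_⟩
      rw [expo_cons, hi, ← congrFun hα k]
      by_cases hk : k = j
      · subst hk; simp [mulVar, add_comm]
      · simp [mulVar, hk, Ne.symm hk]

/-- The monomial `x^α` at the point `(v_1, ..., v_d)`. -/
noncomputable def monEval {d : ℕ} (v : Fin (d + 1) → ℂ) (α : Mon d) : ℂ :=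
  ∏ j : Fin d, v j.succ ^ α j

theorem monEval_add {d : ℕ} (v : Fin (d + 1) → ℂ) (α β : Mon d) :
    monEval v (α + β) = monEval v α * monEval v β := by
  simp [monEval, pow_add, Finset.prod_mul_distrib]

theorem monEval_mulVar {d : ℕ} (v : Fin (d + 1) → ℂ) (j : Fin d) (ν : Mon d) :
    monEval v (mulVar j ν) = v j.succ * monEval v ν := by
  rw [mulVar, monEval_add, mul_comm]
  congr 1
  rw [monEval, Finset.prod_eq_single j]
  · simp
  · intro k _ hk; simp [hk]
  · simp

theorem prod_eq_monEval {m d : ℕ} {v : Fin (d + 1) → ℂ} (hv : v 0 = 1)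
    (i : Fin m → Fin (d + 1)) : ∏ k, v (i k) = monEval v (expo i) := by
  rw [← Finset.prod_fiberwise_of_maps_to (s := Finset.univ) (t := Finset.univ) (g := i)
    (fun _ _ => Finset.mem_univ _), Fin.prod_univ_succ]
  have h : ∀ c : Fin (d + 1), ∏ k with i k = c, v (i k)
      = v c ^ (Finset.univ.filter fun k => i k = c).card := fun c => by
    rw [← Finset.prod_const]
    exact Finset.prod_congr rfl fun k hk => by rw [(Finset.mem_filter.1 hk).2]
  simp only [h, hv, one_pow, one_mul]
  rfl

theorem entry_add {m d : ℕ} (F F' : Tensor m (d + 1)) (α : Mon d) :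
    entry (F + F') α = entry F α + entry F' α := by
  unfold entry; split_ifs <;> simp

theorem entry_smul {m d : ℕ} (c : ℂ) (F : Tensor m (d + 1)) (α : Mon d) :
    entry (c • F) α = c * entry F α := by
  unfold entry; split_ifs <;> simp

theorem norm_entry_le {m d : ℕ} (F : Tensor m (d + 1)) (α : Mon d) : ‖entry F α‖ ≤ ‖F‖ := by
  unfold entry
  split_ifs
  · exact PiLp.norm_apply_le F _
  · simp

theorem entry_weightedSum {m d r : ℕ} (lam : Fin r → ℂ) {v : Fin r → Fin (d + 1) → ℂ}
    (hv : ∀ i, v i 0 = 1) {α : Mon d} (hα : deg α ≤ m) :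
    entry (weightedSum m lam v) α = ∑ i, lam i * monEval (v i) α := by
  have h := exists_expo_eq hα
  unfold entry
  rw [dif_pos h]
  simp only [weightedSum, tpow, WithLp.ofLp_sum, WithLp.ofLp_smul, Finset.sum_apply, Pi.smul_apply,
    smul_eq_mul]
  exact Finset.sum_congr rfl fun i _ => by rw [prod_eq_monEval (hv i), h.choose_spec]

/-- For `deg α > m` the matrix has no rows, so its rank cannot be the positive number of columns. -/
theorem deg_le_of_fullColumnRank {m d r : ℕ} (hr : 1 ≤ r) {F : Tensor m (d + 1)}
    (hF : FullColumnRank r F) {α : Mon d} (hα : α ∈ B1 d r) : deg α ≤ m := by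
  have hcard : 0 < Fintype.card (B0 d r) := Fintype.card_pos_iff.2 ⟨⟨0, zero_mem_B0 hr⟩⟩
  have h := hF α hα ▸ Matrix.rank_le_card_height (matA r F α)
  obtain ⟨γ, hγ⟩ := Fintype.card_pos_iff.1 (hcard.trans_le h)
  have := (Finset.mem_filter.1 hγ).2
  omega

theorem deg_le_of_mem_B0_of_fullColumnRank {m d r : ℕ} (hd : 0 < d) (hr : 1 ≤ r)
    {F : Tensor m (d + 1)} (hF : FullColumnRank r F) {β : Mon d} (hβ : β ∈ B0 d r) :
    deg β ≤ m := by
  obtain ⟨α, hα⟩ := B1_nonempty hd hr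
  exact (deg_le_of_mem_B0 hβ (notMem_B0_of_mem_B1 hα)).trans (deg_le_of_fullColumnRank hr hF hα)

/-! The least squares problem for the generating matrix as a problem in normed spaces. -/

/-- Generating matrices with the maximum norm. -/
abbrev GenSpace (d r : ℕ) : Type := B0 d r → B1 d r → ℂ

/-- The space of residuals. -/
abbrev ResSpace (m d r : ℕ) : Type := EuclideanSpace ℂ (Σ α : B1 d r, rowSet m α.1)

/-- The map `(F, G) ↦ (A[F, α] G(:, α))_α`. -/
noncomputable def genOperator (m d r : ℕ) :
    Tensor m (d + 1) →L[ℂ] GenSpace d r →L[ℂ] ResSpace m d r :=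
  LinearMap.toContinuousLinearMap (LinearMap.toContinuousLinearMap.toLinearMap ∘ₗ
    LinearMap.mk₂ ℂ (fun (F : Tensor m (d + 1)) (G : GenSpace d r) =>
      (WithLp.toLp 2 fun p => ∑ β, entry F (β.1 + p.2.1) * G β p.1 : ResSpace m d r))
      (fun F F' G => by
        ext p; simp [entry_add, add_mul, Finset.sum_add_distrib])
      (fun c F G => by
        ext p; simp [entry_smul, mul_assoc, Finset.mul_sum])
      (fun F G G' => by
        ext p; simp [mul_add, Finset.sum_add_distrib])
      (fun c F G => by
        ext p; simp [mul_left_comm, Finset.mul_sum]))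

/-- The map `F ↦ (b[F, α])_α`. -/
noncomputable def genRhs (m d r : ℕ) : Tensor m (d + 1) →L[ℂ] ResSpace m d r :=
  LinearMap.toContinuousLinearMap
    { toFun := fun F => WithLp.toLp 2 fun p => entry F (p.1.1 + p.2.1)
      map_add' := fun F F' => by ext p; simp [entry_add]
      map_smul' := fun c F => by ext p; simp [entry_smul] }

theorem genOperator_apply {m d r : ℕ} (F : Tensor m (d + 1)) (G : GenSpace d r)
    (p : Σ α : B1 d r, rowSet m α.1) :
    genOperator m d r F G p = (matA r F p.1.1).mulVec (fun β => G β p.1) p.2 := rfl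

theorem genObjective_eq {m d r : ℕ} (F : Tensor m (d + 1)) (G : Matrix (B0 d r) (B1 d r) ℂ) :
    genObjective F G = ‖genOperator m d r F G - genRhs m d r F‖ ^ 2 := by
  rw [EuclideanSpace.norm_sq_eq, Fintype.sum_sigma]
  rfl

theorem fullColumnRank_iff_mulVec {m d r : ℕ} {F : Tensor m (d + 1)} :
    FullColumnRank r F ↔ ∀ α ∈ B1 d r, Function.Injective (matA r F α).mulVec := by
  refine forall₂_congr fun α _ => ?_
  rw [Matrix.mulVec_injective_iff]
  constructor
  · intro h
    rw [linearIndependent_iff_card_eq_finrank_span, ← h, Matrix.rank_eq_finrank_span_cols]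
    rfl
  · intro h
    rw [Matrix.rank_eq_finrank_span_cols]
    exact (linearIndependent_iff_card_eq_finrank_span.1 h).symm

/-- The operator is block diagonal: its block for `α` is `matA r F α`, acting on column `α` of `G`.
-/
theorem fullColumnRank_iff {m d r : ℕ} {F : Tensor m (d + 1)} :
    FullColumnRank r F ↔ Function.Injective (genOperator m d r F) := by
  classical
  rw [fullColumnRank_iff_mulVec]
  constructor
  · intro h G G' hG
    ext β α
    refine congrFun (h α.1 α.2 (a₁ := fun β => G β α) (a₂ := fun β => G' β α) ?_) β
    ext γ
    exact congrArg (fun x : ResSpace m d r => x ⟨α, γ⟩) hG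
  · intro h α hα y y' hy
    have := @h (fun β α' => if α' = ⟨α, hα⟩ then y β else 0)
      (fun β α' => if α' = ⟨α, hα⟩ then y' β else 0) ?_
    · ext β
      simpa using congrFun (congrFun this β) ⟨α, hα⟩
    · ext ⟨α', γ⟩
      rw [genOperator_apply, genOperator_apply]
      by_cases h' : α' = ⟨α, hα⟩
      · subst h'
        simpa using congrFun hy γ
      · simp [h']

/-! Generating matrices of decompositions. -/

/-- The matrix with rows `[v̄_i]_{𝔹₀}`. -/
noncomputable def evalMatrix {d r : ℕ} (v : Fin r → Fin (d + 1) → ℂ) :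
    Matrix (Fin r) (B0 d r) ℂ :=
  fun i β => monEval (v i) β.1

/-- `G` expresses the monomials in `𝔹₁` by those in `𝔹₀` at the points `v̄_i`. -/
def Interpolates {d r : ℕ} (v : Fin r → Fin (d + 1) → ℂ) (G : Matrix (B0 d r) (B1 d r) ℂ) :
    Prop :=
  ∀ i (α : B1 d r), ∑ β, monEval (v i) β.1 * G β α = monEval (v i) α.1

/-- Independent rows make the evaluation matrix surjective, so prescribed values at the points are
attained by combinations of `B0` monomials. -/
theorem exists_interpolates {d r : ℕ} {v : Fin r → Fin (d + 1) → ℂ}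
    (hv : MonomialsIndependent v) : ∃ G, Interpolates v G := by
  have hrank : (evalMatrix v).rank = Fintype.card (Fin r) := LinearIndependent.rank_matrix hv
  have hsurj : Function.Surjective (evalMatrix v).mulVecLin := by
    rw [← LinearMap.range_eq_top]
    refine Submodule.eq_top_of_finrank_eq ?_
    rw [Module.finrank_fintype_fun_eq_card]
    exact hrank
  choose g hg using fun α : B1 d r => hsurj fun i => monEval (v i) α.1
  exact ⟨fun β α => g α β, fun i α => congrFun (hg α) i⟩

/-- Multiplying the interpolation identity at `v i` by `lam i * monEval (v i) γ` and summing over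
`i` gives the equation in row `γ`. -/
theorem genOperator_eq_genRhs {m d r : ℕ} (lam : Fin r → ℂ) {v : Fin r → Fin (d + 1) → ℂ}
    (hv : ∀ i, v i 0 = 1) {G : Matrix (B0 d r) (B1 d r) ℂ} (hG : Interpolates v G) :
    genOperator m d r (weightedSum m lam v) G = genRhs m d r (weightedSum m lam v) := by
  ext ⟨α, γ⟩
  have hγ := (Finset.mem_filter.1 γ.2).2
  have h1 : ∀ β : B0 d r, entry (weightedSum m lam v) (β.1 + γ.1)
      = ∑ i, lam i * monEval (v i) (β.1 + γ.1) := fun β => by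
    refine entry_weightedSum lam hv ?_
    -- The moment formula needs degree at most `m`; beyond it `entry` has the default value `0`.
    have := deg_le_of_mem_B0 β.2 (notMem_B0_of_mem_B1 α.2)
    have h2 : deg (β.1 + γ.1) = deg β.1 + deg γ.1 := Finset.sum_add_distrib
    omega
  have h2 : entry (weightedSum m lam v) (α.1 + γ.1)
      = ∑ i, lam i * monEval (v i) (α.1 + γ.1) := by
    refine entry_weightedSum lam hv ?_
    have h2 : deg (α.1 + γ.1) = deg α.1 + deg γ.1 := Finset.sum_add_distrib
    omega
  change ∑ β : B0 d r, entry (weightedSum m lam v) (β.1 + γ.1) * G β α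
    = entry (weightedSum m lam v) (α.1 + γ.1)
  simp only [h1, h2, Finset.sum_mul]
  rw [Finset.sum_comm]
  refine Finset.sum_congr rfl fun i _ => ?_
  rw [monEval_add, ← hG i α, Finset.sum_mul, Finset.mul_sum]
  exact Finset.sum_congr rfl fun β _ => by rw [monEval_add]; ring

/-- Column `ν` of `multMatrix j G` represents `x_j x^ν` in terms of `B0`, trivially inside `B0` and
by interpolation in `B1`. Evaluation at `v i` therefore multiplies by the coordinate `v i j.succ`.
-/
theorem evalMatrix_mul_multMatrix {d r : ℕ} {v : Fin r → Fin (d + 1) → ℂ}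
    {G : Matrix (B0 d r) (B1 d r) ℂ} (hG : Interpolates v G) (j : Fin d) :
    evalMatrix v * multMatrix j G = Matrix.diagonal (fun i => v i j.succ) * evalMatrix v := by
  ext i ν
  rw [Matrix.diagonal_mul, Matrix.mul_apply]
  change _ = v i j.succ * monEval (v i) ν.1
  rw [← monEval_mulVar]
  by_cases h : mulVar j ν.1 ∈ B0 d r
  · simp only [multMatrix, h, dif_pos, evalMatrix]
    rw [Finset.sum_eq_single ⟨mulVar j ν.1, h⟩]
    · simp
    · intro μ _ hμ
      rw [if_neg fun h' => hμ (Subtype.ext h'), mul_zero]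
    · simp
  · simp only [multMatrix, h, dif_neg, not_false_eq_true, evalMatrix]
    exact hG i ⟨mulVar j ν.1, mulVar_mem_B1 ν.2 h⟩

theorem evalMatrix_mul_combMatrix {d r : ℕ} {v : Fin r → Fin (d + 1) → ℂ}
    {G : Matrix (B0 d r) (B1 d r) ℂ} (hG : Interpolates v G) (ξ : Fin d → ℝ) :
    evalMatrix v * combMatrix ξ G
      = Matrix.diagonal (fun i => ∑ j, (ξ j : ℂ) * v i j.succ) * evalMatrix v := by
  simp only [combMatrix, Matrix.mul_sum, Matrix.mul_smul, evalMatrix_mul_multMatrix hG]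
  ext i ν
  simp [Matrix.sum_apply, Matrix.diagonal_mul, Finset.sum_mul, mul_assoc]

theorem norm_multMatrix_le {d r : ℕ} {R : ℝ} (hR : 1 ≤ R) {G : GenSpace d r} (hG : ‖G‖ ≤ R)
    (j : Fin d) (μ ν : B0 d r) : ‖multMatrix j G μ ν‖ ≤ R := by
  unfold multMatrix
  split_ifs
  · simpa using hR
  · simp; linarith
  · exact ((norm_le_pi_norm (G μ) _).trans (norm_le_pi_norm G μ)).trans hG

theorem norm_multMatrix_sub_le {d r : ℕ} {e : ℝ} {G G' : GenSpace d r} (h : ‖G - G'‖ ≤ e)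
    (j : Fin d) (μ ν : B0 d r) : ‖multMatrix j G μ ν - multMatrix j G' μ ν‖ ≤ e := by
  have he := (norm_nonneg _).trans h
  unfold multMatrix
  split_ifs
  · simpa using he
  · simpa using he
  · exact ((norm_le_pi_norm ((G - G') μ) _).trans (norm_le_pi_norm (G - G') μ)).trans h

theorem norm_weighted_sum_le {d : ℕ} {ξ : Fin d → ℝ} (hξ : ∀ j, 0 < ξ j) (hξ1 : ∑ j, ξ j = 1)
    {f : Fin d → ℂ} {R : ℝ} (hf : ∀ j, ‖f j‖ ≤ R) : ‖∑ j, (ξ j : ℂ) * f j‖ ≤ R := by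
  have : ‖∑ j, (ξ j : ℂ) * f j‖ ≤ ∑ j, ξ j * R := by
    refine (norm_sum_le _ _).trans (Finset.sum_le_sum fun j _ => ?_)
    rw [norm_mul, Complex.norm_real, Real.norm_of_nonneg (hξ j).le]
    exact mul_le_mul_of_nonneg_left (hf j) (hξ j).le
  rwa [← Finset.sum_mul, hξ1, one_mul] at this

theorem combMatrix_apply {d r : ℕ} (ξ : Fin d → ℝ) (G : Matrix (B0 d r) (B1 d r) ℂ)
    (μ ν : B0 d r) : combMatrix ξ G μ ν = ∑ j, (ξ j : ℂ) * multMatrix j G μ ν := by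
  simp [combMatrix, Matrix.sum_apply]

theorem norm_combMatrix_le {d r : ℕ} {ξ : Fin d → ℝ} (hξ : ∀ j, 0 < ξ j) (hξ1 : ∑ j, ξ j = 1)
    {R : ℝ} (hR : 1 ≤ R) {G : GenSpace d r} (hG : ‖G‖ ≤ R) (μ ν : B0 d r) :
    ‖combMatrix ξ G μ ν‖ ≤ R := by
  refine (congrArg norm (combMatrix_apply ξ G μ ν)).trans_le ?_
  exact norm_weighted_sum_le hξ hξ1 fun j => norm_multMatrix_le hR hG j μ ν

theorem norm_combMatrix_sub_le {d r : ℕ} {ξ : Fin d → ℝ} (hξ : ∀ j, 0 < ξ j)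
    (hξ1 : ∑ j, ξ j = 1) {e : ℝ} {G G' : GenSpace d r} (h : ‖G - G'‖ ≤ e) (μ ν : B0 d r) :
    ‖combMatrix ξ G μ ν - combMatrix ξ G' μ ν‖ ≤ e := by
  refine (congrArg norm (congrArg₂ (· - ·) (combMatrix_apply ξ G μ ν)
    (combMatrix_apply ξ G' μ ν))).trans_le ?_
  rw [← Finset.sum_sub_distrib]
  simp only [← mul_sub]
  exact norm_weighted_sum_le hξ hξ1 fun j => norm_multMatrix_sub_le h j μ ν

/-! Conjugation by a unitary matrix. -/

theorem norm_entry_le_one_of_unitary {b n : Type*} [Fintype b] [Fintype n] [DecidableEq n]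
    {Q : Matrix b n ℂ} (hQ : Q.conjTranspose * Q = 1) (a : b) (i : n) : ‖Q a i‖ ≤ 1 := by
  have h := congrFun (congrFun hQ i) i
  rw [Matrix.mul_apply, Matrix.one_apply_eq] at h
  have h2 : ∑ c, ‖Q c i‖ ^ 2 = 1 := by
    have h3 : ((∑ c, ‖Q c i‖ ^ 2 : ℝ) : ℂ) = 1 := by
      rw [← h]
      push_cast
      refine Finset.sum_congr rfl fun c _ => ?_
      rw [Matrix.conjTranspose_apply, ← Complex.conj_mul']
      rfl
    exact_mod_cast h3
  have h4 : ‖Q a i‖ ^ 2 ≤ 1 :=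
    h2 ▸ Finset.single_le_sum (f := fun c => ‖Q c i‖ ^ 2) (fun _ _ => by positivity)
      (Finset.mem_univ a)
  exact (sq_le_one_iff₀ (norm_nonneg _)).1 h4

theorem norm_conj_apply_le {b n : Type*} [Fintype b] [Fintype n] [DecidableEq n]
    {Q : Matrix b n ℂ} (hQ : Q.conjTranspose * Q = 1) {N : Matrix b b ℂ} {R : ℝ}
    (hN : ∀ μ ν, ‖N μ ν‖ ≤ R) (i k : n) :
    ‖(Q.conjTranspose * N * Q) i k‖ ≤ Fintype.card b ^ 2 * R := by
  have h : ‖∑ ν, (∑ μ, Q.conjTranspose i μ * N μ ν) * Q ν k‖ ≤ ∑ _ν : b, ∑ _μ : b, R := by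
    refine (norm_sum_le _ _).trans (Finset.sum_le_sum fun ν _ => ?_)
    rw [norm_mul]
    refine (mul_le_of_le_one_right (norm_nonneg _) (norm_entry_le_one_of_unitary hQ ν k)).trans ?_
    refine (norm_sum_le _ _).trans (Finset.sum_le_sum fun μ _ => ?_)
    rw [norm_mul, Matrix.conjTranspose_apply, norm_star]
    exact (mul_le_of_le_one_left (norm_nonneg _) (norm_entry_le_one_of_unitary hQ μ i)).trans
      (hN μ ν)
  simp only [Finset.sum_const, Finset.card_univ, nsmul_eq_mul] at h
  simp only [Matrix.mul_apply]
  refine h.trans (le_of_eq (by ring))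

theorem norm_conj_sub_apply_le {b n : Type*} [Fintype b] [Fintype n] [DecidableEq n]
    {Q : Matrix b n ℂ} (hQ : Q.conjTranspose * Q = 1) {N N' : Matrix b b ℂ} {e : ℝ}
    (hN : ∀ μ ν, ‖N μ ν - N' μ ν‖ ≤ e) (i k : n) :
    ‖(Q.conjTranspose * N * Q) i k - (Q.conjTranspose * N' * Q) i k‖ ≤ Fintype.card b ^ 2 * e := by
  have := norm_conj_apply_le hQ (N := N - N') hN i k
  rwa [Matrix.mul_sub, Matrix.sub_mul] at this

theorem mul_conj_eq {b n : Type*} [Fintype b] [DecidableEq b] [Fintype n] [DecidableEq n]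
    {Q : Matrix b n ℂ} (hQ : Q * Q.conjTranspose = 1) {W : Matrix n b ℂ} {N : Matrix b b ℂ}
    {θ : n → ℂ} (h : W * N = Matrix.diagonal θ * W) :
    (W * Q) * (Q.conjTranspose * N * Q) = Matrix.diagonal θ * (W * Q) := by
  calc (W * Q) * (Q.conjTranspose * N * Q) = W * (Q * Q.conjTranspose) * N * Q := by
        simp only [Matrix.mul_assoc]
    _ = _ := by rw [hQ, Matrix.mul_one, h, Matrix.mul_assoc]

/-- Right multiplication by `Q.conjTranspose` recovers `W`, so the rows stay independent, and they
now form a square matrix. -/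
theorem isUnit_mul_unitary {b n : Type*} [Fintype b] [DecidableEq b] [Fintype n] [DecidableEq n]
    {Q : Matrix b n ℂ} (hQ : Q * Q.conjTranspose = 1) {W : Matrix n b ℂ}
    (hW : LinearIndependent ℂ W.row) : IsUnit (W * Q) := by
  rw [← Matrix.linearIndependent_rows_iff_isUnit]
  rw [← Matrix.vecMul_injective_iff] at hW ⊢
  intro x y hxy
  refine hW ?_
  have := congrArg (fun z => Matrix.vecMul z Q.conjTranspose) hxy
  simpa [Matrix.vecMul_vecMul, Matrix.mul_assoc, hQ] using this

/-! ### Stability of the points and bounds for the coefficients. -/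

theorem exists_separation {r : ℕ} {θ : Fin r → ℂ} (h : Function.Injective θ) :
    ∃ s : ℝ, 0 < s ∧ ∀ i j, i ≠ j → s ≤ ‖θ i - θ j‖ := by
  have h1 : ∃ s : ℝ, 0 < s ∧ ∀ p ∈ (Finset.univ : Finset (Fin r)).offDiag,
      s ≤ ‖θ p.1 - θ p.2‖ := by
    rcases (Finset.univ : Finset (Fin r)).offDiag.eq_empty_or_nonempty with he | hne
    · exact ⟨1, one_pos, by simp [he]⟩
    · obtain ⟨p, hp, hmin⟩ := Finset.exists_min_image _ (fun p => ‖θ p.1 - θ p.2‖) hne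
      refine ⟨_, norm_pos_iff.2 (sub_ne_zero.2 fun h' => ?_), hmin⟩
      exact (Finset.mem_offDiag.1 hp).2.2 (h h')
  obtain ⟨s, hs, h2⟩ := h1
  exact ⟨s, hs, fun i j hij => h2 (i, j) (by simpa using hij)⟩

theorem norm_pow_apply_le {b : Type*} [Fintype b] [DecidableEq b] {N : Matrix b b ℂ} {R : ℝ}
    (hN : ∀ μ ν, ‖N μ ν‖ ≤ R) (k : ℕ) (μ ν : b) : ‖(N ^ k) μ ν‖ ≤ (Fintype.card b * R) ^ k := by
  have hR : 0 ≤ R := (norm_nonneg _).trans (hN μ ν)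
  induction k generalizing ν with
  | zero =>
    rw [pow_zero, pow_zero, Matrix.one_apply]
    split_ifs <;> simp
  | succ k ih =>
    rw [pow_succ, Matrix.mul_apply]
    have : ‖∑ l, (N ^ k) μ l * N l ν‖ ≤ ∑ _l : b, (Fintype.card b * R) ^ k * R := by
      refine (norm_sum_le _ _).trans (Finset.sum_le_sum fun l _ => ?_)
      rw [norm_mul]
      exact mul_le_mul (ih l) (hN l ν) (norm_nonneg _) (by positivity)
    rw [Finset.sum_const, Finset.card_univ, nsmul_eq_mul] at this
    refine this.trans (le_of_eq (by ring))

/-- The points of a decomposition with separated values `θ`, as functions of its generating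
matrix. -/
theorem exists_points_bound {d r : ℕ} {ξ : Fin d → ℝ} (hξ : ∀ j, 0 < ξ j)
    (hξ1 : ∑ j, ξ j = 1) {v₀ : Fin r → Fin (d + 1) → ℂ} (hind₀ : MonomialsIndependent v₀)
    (hsep₀ : SeparatedBy ξ v₀) {G₀ : GenSpace d r} (hG₀ : Interpolates v₀ G₀) (R₀ : ℝ) :
    ∃ R s η K : ℝ, 1 ≤ R ∧ 0 < s ∧ 0 < η ∧ 0 ≤ K ∧
      ∀ (G G' : GenSpace d r) (v : Fin r → Fin (d + 1) → ℂ) (Q : Matrix (B0 d r) (Fin r) ℂ),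
        ‖G₀‖ ≤ R₀ → ‖G‖ ≤ R₀ → ‖G'‖ ≤ R₀ → ‖G' - G₀‖ ≤ η → ‖G - G'‖ ≤ η →
        Interpolates v G' → MonomialsIndependent v →
        Q.conjTranspose * Q = 1 → Q * Q.conjTranspose = 1 →
        (∀ i j, j < i → (Q.conjTranspose * combMatrix ξ G * Q) i j = 0) →
        (∀ μ ν, ‖combMatrix ξ G' μ ν‖ ≤ R) ∧
        (∀ k, ‖∑ j, (ξ j : ℂ) * v k j.succ‖ ≤ R) ∧
        (∀ i j, i ≠ j →
          s ≤ ‖∑ l, (ξ l : ℂ) * v i l.succ - ∑ l, (ξ l : ℂ) * v j l.succ‖) ∧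
        (∀ k (j : Fin d), ‖v k j.succ‖ ≤ R) ∧
        (∀ k j, ‖(Q.conjTranspose * multMatrix j G * Q) k k‖ ≤ R) ∧
        ∃ τ : Equiv.Perm (Fin r), ∀ k j,
          ‖(Q.conjTranspose * multMatrix j G * Q) (τ k) (τ k) - v k j.succ‖ ≤ K * ‖G - G'‖ := by
  classical
  obtain ⟨s, hs, hsep⟩ := exists_separation hsep₀
  set c : ℝ := (Fintype.card (B0 d r) : ℝ) ^ 2 with hc
  have hc0 : 0 ≤ c := by positivity
  set R₁ : ℝ := max R₀ 1 with hR₁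
  have hR₁1 : 1 ≤ R₁ := le_max_right _ _
  -- The summands bound the entries of the multiplication matrices, their unitary conjugates, and
  -- the eigenvalues of these.
  set R : ℝ := R₁ + c * R₁ + r * (c * R₁) with hR
  have hcR : 0 ≤ c * R₁ := by positivity
  have hrcR : 0 ≤ r * (c * R₁) := by positivity
  have hR0 : 0 ≤ R := by positivity
  obtain ⟨Ka, ηa, hKa, hηa, hA⟩ := exists_eigenvalue_bound r hR0 hs
  obtain ⟨Kb, ηb, hKb, hηb, hB⟩ := exists_eigenvalue_bound r hR0 (half_pos hs)
  obtain ⟨Kd, hKd, hD⟩ := exists_diagonal_bound r hR0 (half_pos hs)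
  -- Conjugation costs the factor `c`. The tolerance `(c + Kb * c) * ‖G - G'‖` covers both the
  -- change of the entries and the shift of the eigenvalues.
  refine ⟨R, s / 2, min ηa ηb / (c + 1), Kd * (c + Kb * c), by linarith, half_pos hs,
    by positivity, by positivity, ?_⟩
  intro G G' v Q hG₀R hGR hGR' hGG₀ hGG' hint hind hQ hQ' hup
  have hle : ∀ x, x ≤ min ηa ηb / (c + 1) → c * x ≤ min ηa ηb := by
    intro x hx
    rw [le_div_iff₀ (by positivity)] at hx
    rcases le_or_gt 0 x with h0 | h0
    · nlinarith
    · exact (mul_nonpos_of_nonneg_of_nonpos hc0 h0.le).trans (by positivity)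
  have hent : ∀ {H : GenSpace d r}, ‖H‖ ≤ R₀ →
      ∀ a b, ‖(Q.conjTranspose * combMatrix ξ H * Q) a b‖ ≤ R := fun hH a b =>
    (norm_conj_apply_le hQ (norm_combMatrix_le hξ hξ1 hR₁1 (hH.trans (le_max_left _ _)))
      a b).trans (by linarith)
  have hentM : ∀ {H : GenSpace d r}, ‖H‖ ≤ R₀ → ∀ j a b,
      ‖(Q.conjTranspose * multMatrix j H * Q) a b‖ ≤ c * R₁ := fun hH j a b =>
    norm_conj_apply_le hQ (norm_multMatrix_le hR₁1 (hH.trans (le_max_left _ _)) j) a b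
  have hU : IsUnit (evalMatrix v * Q) := isUnit_mul_unitary hQ' hind
  have hU₀ : IsUnit (evalMatrix v₀ * Q) := isUnit_mul_unitary hQ' hind₀
  have hrow : ∀ {w : Fin r → Fin (d + 1) → ℂ}, IsUnit (evalMatrix w * Q) → ∀ k,
      (evalMatrix w * Q) k ≠ 0 := fun hw k =>
    (Matrix.linearIndependent_rows_iff_isUnit.2 hw).ne_zero k
  have hconj := mul_conj_eq hQ' (evalMatrix_mul_combMatrix hint ξ)
  have hconjM := fun j => mul_conj_eq hQ' (evalMatrix_mul_multMatrix hint j)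
  have hconj₀ := mul_conj_eq hQ' (evalMatrix_mul_combMatrix hG₀ ξ)
  -- The coordinates are eigenvalues, so `G'` alone bounds them.
  have hv : ∀ k (j : Fin d), ‖v k j.succ‖ ≤ R := by
    intro k j
    have := norm_le_of_vecMul_eq_smul (hrow hU k) (vecMul_row_eq_smul (hconjM j) k)
      (hentM hGR' j)
    rw [Fintype.card_fin] at this
    linarith
  have hθ : ∀ k, ‖∑ j, (ξ j : ℂ) * v k j.succ‖ ≤ R := fun k =>
    norm_weighted_sum_le hξ hξ1 (hv k)
  have hθ₀ : ∀ k, ‖∑ j, (ξ j : ℂ) * v₀ k j.succ‖ ≤ R := by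
    intro k
    refine norm_weighted_sum_le hξ hξ1 fun j => ?_
    have := norm_le_of_vecMul_eq_smul (hrow hU₀ k)
      (vecMul_row_eq_smul (mul_conj_eq hQ' (evalMatrix_mul_multMatrix hG₀ j)) k) (hentM hG₀R j)
    rw [Fintype.card_fin] at this
    linarith
  have hzero : ∀ {N : Matrix (Fin r) (Fin r) ℂ} {W : Matrix (Fin r) (Fin r) ℂ} {θ : Fin r → ℂ},
      IsUnit W → W * N = Matrix.diagonal θ * W →
      ∀ k, (θ k • (1 : Matrix (Fin r) (Fin r) ℂ) - N).det = 0 := by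
    intro N W θ hW h k
    rw [det_smul_one_sub_of_diagonalized hW h]
    exact Finset.prod_eq_zero (Finset.mem_univ k) (sub_self _)
  -- First comparison, `G₀` with `G'`: the values of `v` are within `s / 4` of those of `v₀`, so
  -- they keep the separation `s / 2`.
  obtain ⟨τ₀, hτ₀⟩ := hA _ _ _ _ (c * ‖G' - G₀‖) (hent hG₀R) (hent hGR') hθ₀ hsep
    (hzero hU₀ hconj₀) (det_smul_one_sub_of_diagonalized hU hconj) (by positivity)
    ((hle _ hGG₀).trans (min_le_left _ _))
    (norm_conj_sub_apply_le hQ (norm_combMatrix_sub_le hξ hξ1 le_rfl))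
  have hsep' : ∀ i j, i ≠ j →
      s / 2 ≤ ‖∑ l, (ξ l : ℂ) * v i l.succ - ∑ l, (ξ l : ℂ) * v j l.succ‖ := by
    intro i j hij
    obtain ⟨k, rfl⟩ := τ₀.surjective i
    obtain ⟨l, rfl⟩ := τ₀.surjective j
    have h1 := hsep k l fun h => hij (by rw [h])
    have h2 := (hτ₀ k).1
    have h3 := (hτ₀ l).1
    generalize ∑ j, (ξ j : ℂ) * v (τ₀ k) j.succ = a at *
    generalize ∑ j, (ξ j : ℂ) * v (τ₀ l) j.succ = b at *
    have h4 := norm_sub_le_norm_sub_add_norm_sub (∑ j, (ξ j : ℂ) * v₀ k j.succ) a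
      (∑ j, (ξ j : ℂ) * v₀ l j.succ)
    have h5 := norm_sub_le_norm_sub_add_norm_sub a b (∑ j, (ξ j : ℂ) * v₀ l j.succ)
    rw [norm_sub_rev b] at h5
    linarith
  have hcharT : ∀ z : ℂ, (z • (1 : Matrix (Fin r) (Fin r) ℂ)
      - Q.conjTranspose * combMatrix ξ G * Q).det
        = ∏ i, (z - (Q.conjTranspose * combMatrix ξ G * Q) i i) := by
    intro z
    rw [Matrix.det_of_isUpperTriangular]
    · simp
    · intro i j hij
      have hij' : j < i := hij
      rw [Matrix.sub_apply, hup i j hij', Matrix.smul_apply, Matrix.one_apply_ne hij'.ne',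
        smul_zero, sub_zero]
  have hTP := norm_conj_sub_apply_le hQ (norm_combMatrix_sub_le hξ hξ1 (le_refl ‖G - G'‖))
  -- Second comparison, `G'` with `G`: it matches the values of `v` to the diagonal of the Schur
  -- form.
  obtain ⟨τ, hτ⟩ := hB _ _ _ (fun i => (Q.conjTranspose * combMatrix ξ G * Q) i i)
    (c * ‖G - G'‖) (hent hGR') (hent hGR) hθ hsep' (hzero hU hconj) hcharT (by positivity)
    ((hle _ hGG').trans (min_le_right _ _)) hTP
  refine ⟨fun μ ν => (norm_combMatrix_le hξ hξ1 hR₁1 (hGR'.trans (le_max_left _ _)) μ ν).trans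
    (by linarith), hθ, hsep', hv, fun k j => (hentM hGR j k k).trans (by linarith), τ, ?_⟩
  intro k j
  have he : c * ‖G - G'‖ ≤ (c + Kb * c) * ‖G - G'‖ := by
    have : 0 ≤ Kb * c * ‖G - G'‖ := by positivity
    linarith
  have := hD _ _ _ _ _ _ _ ((c + Kb * c) * ‖G - G'‖) (hent hGR) (hent hGR') hθ
    (fun k => hv k j) hsep' hU hconj (hconjM j) hup (by positivity)
    (fun a b => (hTP a b).trans he)
    (fun a b => (norm_conj_sub_apply_le hQ (norm_multMatrix_sub_le (le_refl ‖G - G'‖) j)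
      a b).trans he) (τ k) k ?_
  · rwa [mul_assoc]
  · rw [norm_sub_rev]
    refine (hτ k).2.trans ?_
    have : 0 ≤ c * ‖G - G'‖ := by positivity
    linarith

/-- The coefficients of a decomposition with separated values `θ` are bounded in terms of the
tensor and its generating matrix. -/
theorem exists_coeff_bound (m : ℕ) {d r : ℕ} (hr : 1 ≤ r) (ξ : Fin d → ℝ) {R s : ℝ} (hR : 0 ≤ R)
    (hs : 0 < s) :
    ∃ Λ : ℝ, 0 ≤ Λ ∧ ∀ (lam : Fin r → ℂ) (v : Fin r → Fin (d + 1) → ℂ)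
      (G : Matrix (B0 d r) (B1 d r) ℂ),
      (∀ β ∈ B0 d r, deg β ≤ m) → (∀ i, v i 0 = 1) → Interpolates v G →
      (∀ μ ν, ‖combMatrix ξ G μ ν‖ ≤ R) → (∀ k, ‖∑ j, (ξ j : ℂ) * v k j.succ‖ ≤ R) →
      (∀ i j, i ≠ j →
        s ≤ ‖∑ l, (ξ l : ℂ) * v i l.succ - ∑ l, (ξ l : ℂ) * v j l.succ‖) →
      ‖weightedSum m lam v‖ ≤ R → ∀ k, ‖lam k‖ ≤ Λ := by
  obtain ⟨B, hB, hvan⟩ := exists_bound_vandermonde_inv r R hs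
  set c : ℝ := (Fintype.card (B0 d r) : ℝ) with hc
  set S : ℝ := ∑ a : Fin r, c * (R * (c * R) ^ (a : ℕ)) with hS
  refine ⟨r * (S * B), by positivity, ?_⟩
  intro lam v G hdeg hv hG hN hθ hsep hX k
  set θ : Fin r → ℂ := fun k => ∑ j, (ξ j : ℂ) * v k j.succ with hθdef
  obtain ⟨hunit, hinv⟩ := hvan θ ((pi_norm_le_iff_of_nonneg hR).2 hθ) hsep
  have hpow : ∀ a : ℕ, evalMatrix v * combMatrix ξ G ^ a
      = Matrix.diagonal (fun k => θ k ^ a) * evalMatrix v := by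
    intro a
    induction a with
    | zero => simp
    | succ a ih =>
      rw [pow_succ, ← Matrix.mul_assoc, ih, Matrix.mul_assoc, evalMatrix_mul_combMatrix hG,
        ← Matrix.mul_assoc, Matrix.diagonal_mul_diagonal]
      simp only [pow_succ, hθdef]
  let z : B0 d r := ⟨0, zero_mem_B0 hr⟩
  -- The column of the monomial `1` in the `a`-th power expresses `θ i ^ a` by `B0` monomials at `v
  -- i`. The moments are thus combinations of tensor entries, and inverting the Vandermonde matrix
  -- bounds `lam`.
  have hmoment : ∀ a : ℕ, ∑ i, lam i * θ i ^ a
      = ∑ β : B0 d r, entry (weightedSum m lam v) β.1 * (combMatrix ξ G ^ a) β z := by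
    intro a
    have h1 : ∀ i, θ i ^ a = ∑ β : B0 d r, monEval (v i) β.1 * (combMatrix ξ G ^ a) β z := by
      intro i
      have := congrFun (congrFun (hpow a) i) z
      rw [Matrix.diagonal_mul] at this
      have h2 : evalMatrix v i z = 1 := by simp [evalMatrix, z, monEval]
      rw [h2, mul_one] at this
      exact this.symm
    have h3 : ∀ β : B0 d r, entry (weightedSum m lam v) β.1 = ∑ i, lam i * monEval (v i) β.1 :=
      fun β => entry_weightedSum lam hv (hdeg β.1 β.2)
    simp only [h3, Finset.sum_mul]
    rw [Finset.sum_comm]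
    refine Finset.sum_congr rfl fun i _ => ?_
    rw [h1 i, Finset.mul_sum]
    exact Finset.sum_congr rfl fun β _ => by ring
  set y : Fin r → ℂ := Matrix.vecMul lam (Matrix.vandermonde θ) with hy
  have hyb : ∀ a, ‖y a‖ ≤ S := by
    intro a
    have h1 : y a = ∑ i, lam i * θ i ^ (a : ℕ) := rfl
    rw [h1, hmoment]
    have h2 : ‖∑ β : B0 d r, entry (weightedSum m lam v) β.1 * (combMatrix ξ G ^ (a : ℕ)) β z‖
        ≤ ∑ _β : B0 d r, R * (c * R) ^ (a : ℕ) := by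
      refine (norm_sum_le _ _).trans (Finset.sum_le_sum fun β _ => ?_)
      rw [norm_mul]
      exact mul_le_mul ((norm_entry_le _ _).trans hX) (norm_pow_apply_le hN _ _ _)
        (norm_nonneg _) hR
    rw [Finset.sum_const, Finset.card_univ, nsmul_eq_mul] at h2
    exact h2.trans (Finset.single_le_sum (f := fun a : Fin r => c * (R * (c * R) ^ (a : ℕ)))
      (fun _ _ => by positivity) (Finset.mem_univ a))
  have hlam : lam = Matrix.vecMul y (Matrix.vandermonde θ)⁻¹ := by
    rw [hy, Matrix.vecMul_vecMul, Matrix.mul_nonsing_inv _ hunit, Matrix.vecMul_one]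
  rw [hlam]
  have h4 : ‖∑ a, y a * (Matrix.vandermonde θ)⁻¹ a k‖ ≤ ∑ _a : Fin r, S * B := by
    refine (norm_sum_le _ _).trans (Finset.sum_le_sum fun a _ => ?_)
    rw [norm_mul]
    exact mul_le_mul (hyb a) (hinv a k) (norm_nonneg _) ((norm_nonneg _).trans (hyb a))
  rw [Finset.sum_const, Finset.card_univ, Fintype.card_fin, nsmul_eq_mul] at h4
  exact h4

theorem exists_tpow_lipschitz (m n : ℕ) (R : ℝ) :
    ∃ K : ℝ, 0 ≤ K ∧ ∀ v w : Fin n → ℂ, ‖v‖ ≤ R → ‖w‖ ≤ R →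
      ‖tpow m v - tpow m w‖ ≤ K * ‖v - w‖ := by
  have hf : ContDiff ℂ 1 fun v : Fin n → ℂ => tpow m v := by
    unfold tpow
    rw [contDiff_euclidean]
    fun_prop
  exact exists_lipschitz_on_bounded hf R

/-! ### The residual estimate near one good decomposition. -/

/-- `v` is a possible result of the steps of the algorithm that compute the points. -/
def IsPointOutput {m d r : ℕ} (ξ : Fin d → ℝ) (F : Tensor m (d + 1))
    (v : Fin r → Fin (d + 1) → ℂ) : Prop :=
  ∃ (G : GenSpace d r) (Q : Matrix (B0 d r) (Fin r) ℂ),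
    (∀ G' : GenSpace d r, genObjective F G ≤ genObjective F G') ∧
    Q.conjTranspose * Q = 1 ∧ Q * Q.conjTranspose = 1 ∧
    (∀ i j, j < i → (Q.conjTranspose * combMatrix ξ G * Q) i j = 0) ∧
    ∀ i, v i = Fin.cons 1 (fun j => (Q.conjTranspose * multMatrix j G * Q) i i)

/-- The local estimate near a decomposition with the required properties. -/
theorem exists_local_bound (m : ℕ) {d r : ℕ} (hr : 1 ≤ r) {ξ : Fin d → ℝ} (hξ : ∀ j, 0 < ξ j)
    (hξ1 : ∑ j, ξ j = 1) {lam₀ : Fin r → ℂ} {v₀ : Fin r → Fin (d + 1) → ℂ}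
    (hv₀ : ∀ i, v₀ i 0 = 1) (hind₀ : MonomialsIndependent v₀)
    (hfull₀ : FullColumnRank r (weightedSum m lam₀ v₀)) (hsep₀ : SeparatedBy ξ v₀) :
    ∃ ρ K : ℝ, 0 < ρ ∧ 0 ≤ K ∧ ∀ (F : Tensor m (d + 1)) (lam : Fin r → ℂ)
      (v w : Fin r → Fin (d + 1) → ℂ),
      ‖F - weightedSum m lam₀ v₀‖ ≤ ρ → ‖weightedSum m lam v - weightedSum m lam₀ v₀‖ ≤ ρ →
      (∀ i, v i 0 = 1) → MonomialsIndependent v → IsPointOutput ξ F w →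
      ∃ mu : Fin r → ℂ, ‖weightedSum m mu w - F‖ ≤ K * ‖F - weightedSum m lam v‖ := by
  have hd : 0 < d := by
    rcases Nat.eq_zero_or_pos d with rfl | h
    · simp at hξ1
    · exact h
  obtain ⟨G₀, hG₀⟩ : ∃ G₀ : GenSpace d r, Interpolates v₀ G₀ := exists_interpolates hind₀
  obtain ⟨ρ₁, K₁, hρ₁, hK₁, -, hLS⟩ := exists_least_squares_bound (genOperator m d r)
    (genRhs m d r) (weightedSum m lam₀ v₀) (fullColumnRank_iff.1 hfull₀)
  obtain ⟨R, s, η, K₂, hR, hs, hη, hK₂, hpts⟩ :=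
    exists_points_bound hξ hξ1 hind₀ hsep₀ hG₀ (K₁ + K₁ * (2 * ρ₁))
  set R' : ℝ := R + ‖weightedSum m lam₀ v₀‖ + ρ₁ with hR'
  obtain ⟨Λ, hΛ, hcoef⟩ := exists_coeff_bound m hr ξ (R := R') (by positivity) hs
  obtain ⟨K₃, hK₃, htp⟩ := exists_tpow_lipschitz m (d + 1) R
  -- Since `F` and the decomposed tensor are at most `2 * ρ` apart, this keeps `‖G - G'‖` below `η`.
  set ρ : ℝ := min ρ₁ (η / (2 * (K₁ + 1))) with hρ
  refine ⟨ρ, r * (Λ * (K₃ * (K₂ * K₁))) + 1, by positivity, by positivity, ?_⟩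
  intro F lam v w hF hX hv hind ⟨G, Q, hmin, hQ, hQ', hup, hw⟩
  obtain ⟨G', hG'⟩ : ∃ G' : GenSpace d r, Interpolates v G' := exists_interpolates hind
  have hρle : ρ ≤ ρ₁ := min_le_left _ _
  have hρη : K₁ * (2 * ρ) ≤ η := by
    have : ρ ≤ η / (2 * (K₁ + 1)) := min_le_right _ _
    rw [le_div_iff₀ (by positivity)] at this
    have : 0 < ρ := by positivity
    nlinarith
  have hex := genOperator_eq_genRhs (m := m) lam hv hG'
  have hex₀ := genOperator_eq_genRhs (m := m) lam₀ hv₀ hG₀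
  have hFX : ‖F - weightedSum m lam v‖ ≤ 2 * ρ := by
    have := norm_sub_le_norm_sub_add_norm_sub F (weightedSum m lam₀ v₀) (weightedSum m lam v)
    rw [norm_sub_rev (weightedSum m lam₀ v₀)] at this
    linarith
  have hzero : ‖weightedSum m lam₀ v₀ - weightedSum m lam₀ v₀‖ ≤ ρ₁ := by simpa using hρ₁.le
  have h1 := hLS F _ G G' (hF.trans hρle) (hX.trans hρle) hex (by
    refine (sq_le_sq₀ (norm_nonneg _) (norm_nonneg _)).1 ?_
    exact (genObjective_eq F G).symm.trans_le ((hmin G').trans_eq (genObjective_eq F G')))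
  -- The same estimate with the decomposed tensor as data: `G'` has residual zero, so it is a
  -- minimizer and lies near `G₀`.
  have h2 := hLS (weightedSum m lam v) _ G' G₀ (hX.trans hρle) hzero hex₀ (by
    rw [hex, sub_self, norm_zero]; exact norm_nonneg _)
  have hGG' : ‖G - G'‖ ≤ K₁ * (2 * ρ) :=
    h1.2.trans (mul_le_mul_of_nonneg_left hFX hK₁)
  have hG'G₀ : ‖G' - G₀‖ ≤ η :=
    h2.2.trans ((mul_le_mul_of_nonneg_left
      (hX.trans (by linarith [(norm_nonneg _).trans hX])) hK₁).trans hρη)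
  have hGn : ‖G‖ ≤ K₁ + K₁ * (2 * ρ₁) := by
    have h3 := norm_le_norm_add_norm_sub' G G'
    have h4 : K₁ * (2 * ρ) ≤ K₁ * (2 * ρ₁) := mul_le_mul_of_nonneg_left (by linarith) hK₁
    linarith [h1.1]
  have hpos : 0 ≤ K₁ * (2 * ρ₁) := by positivity
  obtain ⟨hN, hθ, hsep, hvR, hwR, τ, hτ⟩ := hpts G G' v Q (h2.1.trans (by linarith)) hGn
    (h1.1.trans (by linarith)) hG'G₀ (hGG'.trans hρη) hG' hind hQ hQ' hup
  have hlam := hcoef lam v G' (fun β hβ => deg_le_of_mem_B0_of_fullColumnRank hd hr hfull₀ hβ)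
    hv hG'
    (fun μ ν => (hN μ ν).trans (by linarith [norm_nonneg (weightedSum m lam₀ v₀)]))
    (fun k => (hθ k).trans (by linarith [norm_nonneg (weightedSum m lam₀ v₀)])) hsep (by
      have := norm_le_norm_add_norm_sub' (weightedSum m lam v) (weightedSum m lam₀ v₀)
      linarith)
  have hR0 : 0 ≤ R := by linarith
  have hvn : ∀ k, ‖v k‖ ≤ R := fun k => (pi_norm_le_iff_of_nonneg hR0).2 fun j => by
    refine Fin.cases ?_ (fun j => hvR k j) j
    rw [hv k]; simpa using hR
  have hwn : ∀ k, ‖w k‖ ≤ R := fun k => (pi_norm_le_iff_of_nonneg hR0).2 fun j => by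
    rw [hw k]
    refine Fin.cases ?_ (fun j => ?_) j
    · simpa using hR
    · simpa using hwR k j
  have hdist : ∀ k, ‖w (τ k) - v k‖ ≤ K₂ * (K₁ * ‖F - weightedSum m lam v‖) := fun k => by
    refine (pi_norm_le_iff_of_nonneg (by positivity)).2 fun j => ?_
    rw [Pi.sub_apply, hw]
    refine Fin.cases ?_ (fun j => ?_) j
    · rw [hv k]; simp; positivity
    · simpa using (hτ k j).trans (mul_le_mul_of_nonneg_left h1.2 hK₂)
  -- The old coefficients, carried along the matching of the points.
  refine ⟨fun i => lam (τ.symm i), ?_⟩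
  have hsum : weightedSum m (fun i => lam (τ.symm i)) w
      = ∑ k, lam k • tpow m (w (τ k)) := by
    rw [weightedSum, ← Equiv.sum_comp τ]
    simp
  have hsplit : weightedSum m (fun i => lam (τ.symm i)) w - F
      = ∑ k, lam k • (tpow m (w (τ k)) - tpow m (v k)) - (F - weightedSum m lam v) := by
    simp only [hsum, smul_sub, Finset.sum_sub_distrib]
    rw [weightedSum]
    abel
  rw [hsplit]
  refine (norm_sub_le _ _).trans ?_
  have hfin : ‖∑ k, lam k • (tpow m (w (τ k)) - tpow m (v k))‖
      ≤ ∑ _k : Fin r, Λ * (K₃ * (K₂ * (K₁ * ‖F - weightedSum m lam v‖))) := by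
    refine (norm_sum_le _ _).trans (Finset.sum_le_sum fun k _ => ?_)
    rw [norm_smul]
    exact mul_le_mul (hlam k) ((htp _ _ (hwn _) (hvn _)).trans
      (mul_le_mul_of_nonneg_left (hdist k) hK₃)) (norm_nonneg _) hΛ
  rw [Finset.sum_const, Finset.card_univ, Fintype.card_fin, nsmul_eq_mul] at hfin
  calc _ ≤ r * (Λ * (K₃ * (K₂ * (K₁ * ‖F - weightedSum m lam v‖)))) + ‖F - weightedSum m lam v‖ :=
        add_le_add hfin le_rfl
    _ = _ := by ring

/-! Outputs of the algorithm, and the constants of the error estimate. -/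

theorem tpow_smul (m : ℕ) {n : ℕ} (w : ℂ) (v : Fin n → ℂ) : tpow m (w • v) = w ^ m • tpow m v := by
  ext i
  simp [tpow, Finset.prod_mul_distrib]

/-- The choice of the roots cancels in `u_i^{⊗m} = lam_i v_i^{⊗m}`. So `Xgp` is a best combination
of the powers of the computed points, and any coefficients bound its error from above. -/
theorem IsOutput.exists_points {m d r : ℕ} {ξ : Fin d → ℝ} {F Xgp Xopt : Tensor m (d + 1)}
    (h : IsOutput r ξ F Xgp Xopt) :
    ‖F - Xopt‖ ≤ ‖F - Xgp‖ ∧ ∃ w : Fin r → Fin (d + 1) → ℂ, IsPointOutput ξ F w ∧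
      ∀ mu, ‖F - Xgp‖ ≤ ‖weightedSum m mu w - F‖ := by
  obtain ⟨G, Q, T, w, lam, u, uopt, hmin, hQ, hT, hup, hw, hlam, hu, rfl, hopt, rfl⟩ := h
  have hX : powerSum m u = weightedSum m lam w := by
    refine Finset.sum_congr rfl fun i _ => ?_
    obtain ⟨z, hz, hz'⟩ := hu i
    rw [hz', tpow_smul, hz]
  refine ⟨?_, w, ⟨G, Q, hmin, hQ.1, hQ.2, fun i j hij => ?_, hw⟩, fun mu => ?_⟩
  · rw [norm_sub_rev F, norm_sub_rev F]
    exact (sq_le_sq₀ (norm_nonneg _) (norm_nonneg _)).1 hopt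
  · rw [hT]; exact hup i j hij
  · rw [hX, norm_sub_rev]
    exact (sq_le_sq₀ (norm_nonneg _) (norm_nonneg _)).1 (hlam mu)

/-- The constants that bound the error of the algorithm for the tensor `F`, uniformly in all
decompositions that approximate `F` up to the tolerance `δ`. -/
def errorConstants {m d r : ℕ} (ξ : Fin d → ℝ) (δ : (Fin r → ℂ) → (Fin r → Fin (d + 1) → ℂ) → ℝ)
    (F : Tensor m (d + 1)) : Set ℝ :=
  {K | 0 ≤ K ∧ ∀ lam v, (∀ i, v i 0 = 1) → MonomialsIndependent v → SeparatedBy ξ v →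
    ‖F - weightedSum m lam v‖ < δ lam v → ∀ Xgp Xopt, IsOutput r ξ F Xgp Xopt →
      ‖F - Xgp‖ ≤ K * ‖F - weightedSum m lam v‖}

/-- It suffices to consider decompositions of tensors near `F`. -/
theorem max_mem_errorConstants {m d r : ℕ} {ξ : Fin d → ℝ}
    {δ : (Fin r → ℂ) → (Fin r → Fin (d + 1) → ℂ) → ℝ} {F : Tensor m (d + 1)} {ρ K : ℝ}
    (hρ : 0 < ρ) (hK : 0 ≤ K)
    (h : ∀ lam v, (∀ i, v i 0 = 1) → MonomialsIndependent v → SeparatedBy ξ v →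
      ‖F - weightedSum m lam v‖ < δ lam v → ‖F - weightedSum m lam v‖ < ρ →
        ∀ w : Fin r → Fin (d + 1) → ℂ, IsPointOutput ξ F w →
          ∃ mu : Fin r → ℂ, ‖weightedSum m mu w - F‖ ≤ K * ‖F - weightedSum m lam v‖) :
    max K (‖F‖ / ρ) ∈ errorConstants ξ δ F := by
  refine ⟨le_max_of_le_left hK, fun lam v hv hind hsep hδ Xgp Xopt hout => ?_⟩
  obtain ⟨-, w, hw, hopt⟩ := hout.exists_points
  rcases lt_or_ge ‖F - weightedSum m lam v‖ ρ with hlt | hge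
  · obtain ⟨mu, hmu⟩ := h lam v hv hind hsep hδ hlt w hw
    exact (hopt mu).trans (hmu.trans (mul_le_mul_of_nonneg_right (le_max_left _ _)
      (norm_nonneg _)))
  -- Comparison with zero coefficients; for `ε ≥ ρ` the constant `‖F‖ / ρ` is enough.
  · have h0 : ‖F - Xgp‖ ≤ ‖F‖ := by
      simpa [weightedSum] using hopt 0
    refine h0.trans (le_trans ?_ (mul_le_mul_of_nonneg_right (le_max_right _ _) (norm_nonneg _)))
    rw [div_mul_eq_mul_div, le_div_iff₀ hρ]
    exact mul_le_mul_of_nonneg_left hge (norm_nonneg _)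

end GenPoly

/-! ### The choice of `C` and `δ`. -/

theorem mainTheorem1 (m d r : ℕ) (hm : 1 ≤ m) (hr : 1 ≤ r)
    (ξ : Fin d → ℝ) (hξ : ∀ j, 0 < ξ j) (hξ1 : ∑ j, ξ j = 1) :
    -- `C F` bounds the constants in `O(ε)`; `δ lam v` says how small `ε` has to be
    ∃ (C : GenPoly.Tensor m (d + 1) → ℝ) (δ : (Fin r → ℂ) → (Fin r → Fin (d + 1) → ℂ) → ℝ),
      (∀ lam v, 0 < δ lam v) ∧
      -- the main estimate
      (∀ (F : GenPoly.Tensor m (d + 1)) (lam : Fin r → ℂ) (v : Fin r → Fin (d + 1) → ℂ),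
        GenPoly.IsSymmetric F →
        (∀ i, v i 0 = 1) →
        GenPoly.MonomialsIndependent v →
        GenPoly.FullColumnRank r F →
        GenPoly.IsOptimalScaling F v lam →
        GenPoly.SeparatedBy ξ v →
        ‖F - GenPoly.weightedSum m lam v‖ < δ lam v →
        ∀ Xgp Xopt : GenPoly.Tensor m (d + 1), GenPoly.IsOutput r ξ F Xgp Xopt →
          ‖GenPoly.weightedSum m lam v - Xgp‖ ≤ C F * ‖F - GenPoly.weightedSum m lam v‖ ∧
          ‖F - Xopt‖ ≤ ‖F - Xgp‖ ∧
          ‖F - Xgp‖ ≤ C F * ‖F - GenPoly.weightedSum m lam v‖) ∧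
      -- `C` stays bounded when `F` approaches a tensor `Xbs` satisfying the assumptions
      (∀ (lam : Fin r → ℂ) (v : Fin r → Fin (d + 1) → ℂ),
        (∀ i, v i 0 = 1) →
        GenPoly.MonomialsIndependent v →
        GenPoly.FullColumnRank r (GenPoly.weightedSum m lam v) →
        GenPoly.SeparatedBy ξ v →
        ∃ K : ℝ, ∀ᶠ F in nhds (GenPoly.weightedSum m lam v), C F ≤ K) := by
  open GenPoly in
  have hloc : ∀ (lam₀ : Fin r → ℂ) (v₀ : Fin r → Fin (d + 1) → ℂ), ∃ ρ K : ℝ, 0 < ρ ∧ 0 ≤ K ∧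
      ((∀ i, v₀ i 0 = 1) → MonomialsIndependent v₀ →
        FullColumnRank r (weightedSum m lam₀ v₀) → SeparatedBy ξ v₀ →
        ∀ (F : Tensor m (d + 1)) (lam : Fin r → ℂ) (v w : Fin r → Fin (d + 1) → ℂ),
          ‖F - weightedSum m lam₀ v₀‖ ≤ ρ →
          ‖weightedSum m lam v - weightedSum m lam₀ v₀‖ ≤ ρ →
          (∀ i, v i 0 = 1) → MonomialsIndependent v → IsPointOutput ξ F w →
          ∃ mu : Fin r → ℂ, ‖weightedSum m mu w - F‖ ≤ K * ‖F - weightedSum m lam v‖) := by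
    intro lam₀ v₀
    by_cases h : (∀ i, v₀ i 0 = 1) ∧ MonomialsIndependent v₀ ∧
        FullColumnRank r (weightedSum m lam₀ v₀) ∧ SeparatedBy ξ v₀
    · obtain ⟨ρ, K, hρ, hK, hest⟩ := exists_local_bound m hr hξ hξ1 h.1 h.2.1 h.2.2.1 h.2.2.2
      exact ⟨ρ, K, hρ, hK, fun _ _ _ _ => hest⟩
    -- Dummy values that make `ρ` and `K` total, with `ρ` positive everywhere.
    · exact ⟨1, 0, one_pos, le_rfl, fun h1 h2 h3 h4 => absurd ⟨h1, h2, h3, h4⟩ h⟩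
  choose ρ K hρ hK hest using hloc
  -- Half the radius: if `F` is within `δ` of the centre and another decomposition is within `δ` of
  -- `F`, that decomposition stays in the ball of radius `ρ`.
  let δ : (Fin r → ℂ) → (Fin r → Fin (d + 1) → ℂ) → ℝ := fun lam v => ρ lam v / 2
  have hδ : ∀ lam v, 0 < δ lam v := fun lam v => half_pos (hρ lam v)
  have hnear : ∀ (F : GenPoly.Tensor m (d + 1)) (lam₀ : Fin r → ℂ) (v₀ : Fin r → Fin (d + 1) → ℂ),
      (∀ i, v₀ i 0 = 1) → GenPoly.MonomialsIndependent v₀ →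
      GenPoly.FullColumnRank r (GenPoly.weightedSum m lam₀ v₀) → GenPoly.SeparatedBy ξ v₀ →
      ‖F - GenPoly.weightedSum m lam₀ v₀‖ < δ lam₀ v₀ →
      max (K lam₀ v₀) (‖F‖ / δ lam₀ v₀) ∈ GenPoly.errorConstants ξ δ F := by
    intro F lam₀ v₀ h1 h2 h3 h4 hF
    refine GenPoly.max_mem_errorConstants (hδ lam₀ v₀) (hK lam₀ v₀) ?_
    intro lam v hv hind _ _ hlt w hw
    have hρδ : ρ lam₀ v₀ = δ lam₀ v₀ + δ lam₀ v₀ := (add_halves _).symm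
    have hpos := hδ lam₀ v₀
    refine hest lam₀ v₀ h1 h2 h3 h4 F lam v w (by linarith) ?_ hv hind hw
    have := norm_sub_le_norm_sub_add_norm_sub (GenPoly.weightedSum m lam v) F
      (GenPoly.weightedSum m lam₀ v₀)
    rw [norm_sub_rev _ F] at this
    linarith
  have hne : ∀ F : GenPoly.Tensor m (d + 1), GenPoly.FullColumnRank r F →
      (GenPoly.errorConstants ξ δ F).Nonempty := by
    intro F hF
    -- Either some good decomposition lies within its own tolerance of `F` and serves as centre, or
    -- none does. In the second case full column rank persists in a ball around `F`, so an
    -- admissible decomposition in it would be good; only `ε ≥ σ` remains, where the bound by `‖F‖`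
    -- applies.
    by_cases h : ∃ (lam₀ : Fin r → ℂ) (v₀ : Fin r → Fin (d + 1) → ℂ),
      (∀ i, v₀ i 0 = 1) ∧ GenPoly.MonomialsIndependent v₀ ∧
      GenPoly.FullColumnRank r (GenPoly.weightedSum m lam₀ v₀) ∧ GenPoly.SeparatedBy ξ v₀ ∧
      ‖F - GenPoly.weightedSum m lam₀ v₀‖ < δ lam₀ v₀
    · obtain ⟨lam₀, v₀, h1, h2, h3, h4, h5⟩ := h
      exact ⟨_, hnear F lam₀ v₀ h1 h2 h3 h4 h5⟩
    · obtain ⟨σ, -, hσ, -, hinj, -⟩ := GenPoly.exists_least_squares_bound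
        (GenPoly.genOperator m d r) (GenPoly.genRhs m d r) F (GenPoly.fullColumnRank_iff.1 hF)
      refine ⟨_, GenPoly.max_mem_errorConstants hσ le_rfl ?_⟩
      intro lam v hv hind hsep hlt hlt' w hw
      refine absurd ⟨lam, v, hv, hind, GenPoly.fullColumnRank_iff.2 (hinj _ ?_), hsep, hlt⟩ h
      rw [norm_sub_rev]
      exact hlt'.le
  -- One unit gives an admissible constant above the infimum, which need not be attained a priori;
  -- the other pays for the triangle inequality from `F` to the given decomposition.
  refine ⟨fun F => sInf (GenPoly.errorConstants ξ δ F) + 2, δ, hδ, ?_, ?_⟩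
  · intro F lam v _ hv hind hF _ hsep hlt Xgp Xopt hout
    obtain ⟨k, hk, hk'⟩ := exists_lt_of_csInf_lt (hne F hF) (lt_add_one _)
    have hgp := (hk.2 lam v hv hind hsep hlt Xgp Xopt hout).trans
      (mul_le_mul_of_nonneg_right hk'.le (norm_nonneg _))
    have htri := norm_sub_le_norm_sub_add_norm_sub (GenPoly.weightedSum m lam v) F Xgp
    rw [norm_sub_rev _ F] at htri
    have hε := norm_nonneg (F - GenPoly.weightedSum m lam v)
    refine ⟨?_, hout.exists_points.1, ?_⟩
    · linarith
    · linarith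
  · intro lam v hv hind hfull hsep
    have hpos := hδ lam v
    refine ⟨max (K lam v) ((‖GenPoly.weightedSum m lam v‖ + δ lam v) / δ lam v) + 2, ?_⟩
    filter_upwards [Metric.ball_mem_nhds (GenPoly.weightedSum m lam v) hpos] with F hF
    rw [mem_ball_iff_norm] at hF
    -- The limit decomposition itself is the centre for every `F` in the ball, so one admissible
    -- constant bounds the infimum there.
    have h1 : sInf (GenPoly.errorConstants ξ δ F) ≤ max (K lam v) (‖F‖ / δ lam v) :=
      csInf_le ⟨0, fun k hk => hk.1⟩ (hnear F lam v hv hind hfull hsep hF)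
    have h2 := norm_le_norm_add_norm_sub' F (GenPoly.weightedSum m lam v)
    have h3 : ‖F‖ / δ lam v ≤ (‖GenPoly.weightedSum m lam v‖ + δ lam v) / δ lam v :=
      div_le_div_of_nonneg_right (by linarith) hpos.le
    have h4 := max_le_max (le_refl (K lam v)) h3
    linarith
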